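/- Let $1<p<\infty$ and let $(Y,d,\mu)$ be a compact metric space with a Borel measure $\mu$ that is doubling, i.e. for some $C_d\ge 1$ we have $0<\mu(B(x,2r))\le C_d\,\mu(B(x,r))<\infty$ for all $x\in Y$, $r>0$. A Borel function $g:Y\to[0,\infty]$ is an upper gradient of $u:Y\to\mathbb R$ if $|u(x)-u(y)|\le\int_\gamma g\,ds$ for every non-constant compact rectifiable curve $\gamma$ in $Y$ with end points $x,y$. Let $N^{1,p}(Y)$ be the class of all $u:Y\to\mathbb R$ in $L^p(Y,\mu)$ that have an upper gradient in $L^p(Y,\mu)$, and put $\mathcal E_p(u)^p=\inf_g\int_Y g^p\,d\mu$, the infimum being over all upper gradients $g$ of $u$ (so $\mathcal E_p(u)^p=\int_Y g_u^p\,d\mu$ for the minimal $p$-weak upper gradient $g_u$ of $u$). Suppose that $Y$ supports a $p$-Poincaré inequality: there are $C_P>0$ and $\lambda\ge 1$ such that for all $u\in N^{1,p}(Y)$, all upper gradients $g$ of $u$ and all balls $B(x,r)$, with $u_B$ the mean value of $u$ over $B=B(x,r)$, \[ \frac1{\mu(B(x,r))}\int_{B(x,r)}|u-u_B|\,d\mu\le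 C_P\,r\left(\frac1{\mu(B(x,\lambda r))}\int_{B(x,\lambda r)}g^p\,d\mu\right)^{1/p}. \] For $x\in Y$, $r>0$ and a compact set $K\subset \overline B(x,r)$, let \[ \operatorname{cap}_p(K,Y\setminus B(x,2r))=\inf_u\mathcal E_p(u)^p, \] the infimum being over all $u\in N^{1,p}(Y)$ with $u\ge 1$ on $K$ and $u=0$ on $Y\setminus B(x,2r)$ (pointwise everywhere). Here $\overline B(x,r)=\{y\in Y: d(x,y)\le r\}$. Let $E\subset Y$ be closed and let $\nu$ be a Borel measure on $Y$ with $\nu(Y\setminus E)=0$. Suppose that there are constants $C\ge1$ and $0<\Theta<p$ such that for all $x\in E$ and $0<r\le\operatorname{diam}(E)$, \[ \frac1C\,\frac{\mu(B(x,r))}{r^\Theta}\le\nu(B(x,r))\le C\,\frac{\mu(B(x,r))}{r^\Theta}. \] Then there is a constant $\Lambda>0$ such that for all $x\in E$ and $0<r<\tfrac14\operatorname{diam}(E)$, \[ \frac{\operatorname{cap}_p(\overline B(x,r)\cap E,\;Y\setminus B(x,2r))}{\operatorname{cap}_p(\overline B(x,r),\;Y\setminus B(x,2r))}\ge\Lambda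 . \] -/

import Mathlib

open MeasureTheory Metric Set
open scoped ENNReal

namespace MetricSobolev

variable {Y : Type*} [MetricSpace Y] [MeasurableSpace Y]

/-- `g` is an upper gradient of `u`: a Borel function with values in `[0, ∞]` such that
`|u(x) - u(y)| ≤ ∫_γ g ds` for every non-constant compact rectifiable curve `γ` with end points
`x` and `y`. Each such curve is taken in its arc-length parametrization `γ : [0, L] → Y`, where
`L > 0` is its length, so that `∫_γ g ds = ∫_0^L g(γ(t)) dt`. -/
def IsUpperGradient (g : Y → ℝ≥0∞) (u : Y → ℝ) : Prop :=
  Measurable g ∧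
    ∀ (L : ℝ) (γ : ℝ → Y), 0 < L → HasUnitSpeedOn γ (Icc 0 L) →
      ENNReal.ofReal |u (γ 0) - u (γ L)| ≤ ∫⁻ t in Icc 0 L, g (γ t)

/-- The Newton-Sobolev class `N^{1,p}(Y)`: functions (defined at every point) in `L^p(μ)` that have
an upper gradient in `L^p(μ)`. -/
def MemNewtonSobolev (p : ℝ) (μ : Measure Y) (u : Y → ℝ) : Prop :=
  MemLp u (ENNReal.ofReal p) μ ∧
    ∃ g : Y → ℝ≥0∞, IsUpperGradient g u ∧ ∫⁻ y, g y ^ p ∂μ < ∞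

/-- The `p`-energy of `u`: the infimum of `∫ g^p dμ` over all upper gradients `g` of `u`. This is
`∫ g_u^p dμ` for the minimal `p`-weak upper gradient `g_u` of `u`, which is the `L^p`-limit of a
norm-minimizing sequence of upper gradients. -/
noncomputable def energy (p : ℝ) (μ : Measure Y) (u : Y → ℝ) : ℝ≥0∞ :=
  ⨅ (g : Y → ℝ≥0∞) (_ : IsUpperGradient g u), ∫⁻ y, g y ^ p ∂μ

/-- The relative `p`-capacity `cap_p(K, F)`: the infimum of the `p`-energies of all
`u ∈ N^{1,p}(Y)` with `u ≥ 1` everywhere on `K` and `u = 0` everywhere on `F`. -/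
noncomputable def relCapacity (p : ℝ) (μ : Measure Y) (K F : Set Y) : ℝ≥0∞ :=
  ⨅ (u : Y → ℝ) (_ : MemNewtonSobolev p μ u) (_ : ∀ y ∈ K, 1 ≤ u y) (_ : ∀ y ∈ F, u y = 0),
    energy p μ u

/-- `μ` is a doubling measure. -/
def IsDoubling (μ : Measure Y) : Prop :=
  ∃ C : ℝ, 1 ≤ C ∧ ∀ (x : Y) (r : ℝ), 0 < r →
    0 < μ (ball x (2 * r)) ∧ μ (ball x (2 * r)) ≤ ENNReal.ofReal C * μ (ball x r) ∧
      μ (ball x r) < ∞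

/-- The `p`-Poincaré inequality, for all `u ∈ N^{1,p}(Y)`, all upper gradients `g` of `u` and all
balls. Here `⨍` and `⨍⁻` are mean values. -/
def SupportsPoincare (p : ℝ) (μ : Measure Y) : Prop :=
  ∃ C l : ℝ, 0 < C ∧ 1 ≤ l ∧
    ∀ u : Y → ℝ, MemNewtonSobolev p μ u → ∀ g : Y → ℝ≥0∞, IsUpperGradient g u →
      ∀ (x : Y) (r : ℝ), 0 < r →
        ⨍⁻ y in ball x r, ENNReal.ofReal |u y - ⨍ z in ball x r, u z ∂μ| ∂μ ≤
          ENNReal.ofReal (C * r) * (⨍⁻ y in ball x (l * r), g y ^ p ∂μ) ^ (1 / p)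

/-- The measure `ν` lives on `E` and is `Θ`-codimensional there with respect to `μ`: for all
`x ∈ E` and `0 < r ≤ diam E`, `ν(B(x,r))` is comparable to `μ(B(x,r)) / r^Θ`. -/
def IsCodimensional (Θ : ℝ) (μ ν : Measure Y) (E : Set Y) : Prop :=
  ν Eᶜ = 0 ∧ ∃ C : ℝ, 1 ≤ C ∧ ∀ x ∈ E, ∀ r : ℝ, 0 < r → r ≤ diam E →
    ENNReal.ofReal (1 / C) * (μ (ball x r) / ENNReal.ofReal (r ^ Θ)) ≤ ν (ball x r) ∧
      ν (ball x r) ≤ ENNReal.ofReal C * (μ (ball x r) / ENNReal.ofReal (r ^ Θ))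

end MetricSobolev

/-!
Write `F` for the complement of `B(x, 2r)` and `K` for the part of `E` in the closed ball of radius
`r` around `x`. The capacity of the closed ball relative to `F` is finite (test with a cutoff
function) and positive (Poincaré inequality on all of `Y`; `F` contains a ball because
`r < diam E / 4`). So it suffices to bound it by a constant times the capacity of `K`. As `F` may be
very small when `r` is close to `diam E / 4`, neither capacity need be comparable to
`μ(B(x, r)) / r ^ p`, and the two are compared directly: from a competitor for `K` one constructs a
competitor for the closed ball.

Let `u` be a competitor for `K` with upper gradient `g`. The points of `K` need not be Lebesgue
points of `u`, since `E` is a `μ`-null set. By the Vitali-Carathéodory theorem one may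
enlarge `g` to be lower semicontinuous and bounded away from `0`, at arbitrarily small cost
(`exists_lowerSemicontinuous_rpow_le`). Then `u` is replaced by `v = min(V, 1)`, where `V(y)` is
the infimum of `∫_γ g` over curves `γ` from `y` to `F` (`pathInf`). The function `g` is an upper
gradient of `v`, `v = 0` on `F`, and `v = 1` on `K` because `g` is an upper gradient of `u`
(`one_le_pathInf`). Moreover `v` is lower semicontinuous, by the Arzelà-Ascoli theorem and Fatou's
lemma (`lowerSemicontinuous_pathInf`). Since `v ≤ 1`, this makes `v` continuous at the points of
`K`, and its averages over small balls around these points converge to `1`.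

Telescoping along dyadic balls with the Poincaré inequality bounds `|v(y) - m| ^ p`, with `m` the
mean of `v` over `B(x, 4r)`, by `r ^ p` times a weighted sum of averages of `g ^ p` over balls of
radius `2^{-i} r` around `y` (`exists_enorm_sub_average_rpow_le`), for `y ∈ K` and for `μ`-almost
every `y ∈ B(x, 2r)`. Integrating over `K` against `ν` and using `Θ < p`, and integrating over
`B(x, 2r)` against `μ` (both by `exists_lintegral_scaleSum_le`), gives the Maz'ya type inequality
`∫_{B(x, 2r)} (1 - v) ^ p dμ ≤ C r ^ p ∫ g ^ p dμ` (`exists_setLIntegral_one_sub_rpow_le`).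

Finally, with `φ` the cutoff function that is `1` on the closed ball and `0` on `F`, the function
`v + φ (1 - v)` is `1` on the closed ball, `0` on `F`, and has the upper gradient
`g + (1 - v) r⁻¹ 1_{B(x, 2r)}` (`IsUpperGradient.add_mul_one_sub`), whose `p`-energy is at most
`C ∫ g ^ p dμ` by the Maz'ya type inequality.
-/

namespace MetricSobolev

open Filter Topology

variable {Y : Type*} [MetricSpace Y] [MeasurableSpace Y]

/-! ### Doubling measures and averages over balls -/

theorem IsDoubling.measure_ball_pos {μ : Measure Y} (hμ : IsDoubling μ) (x : Y) {r : ℝ}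
    (hr : 0 < r) : 0 < μ (ball x r) := by
  obtain ⟨C, -, h⟩ := hμ
  simpa [mul_div_cancel₀] using (h x (r / 2) (by positivity)).1

theorem IsDoubling.measure_ball_lt_top {μ : Measure Y} (hμ : IsDoubling μ) (x : Y) (r : ℝ) :
    μ (ball x r) < ∞ := by
  rcases le_or_gt r 0 with hr | hr
  · simp [ball_eq_empty.2 hr]
  · obtain ⟨C, -, h⟩ := hμ
    exact (h x r hr).2.2

theorem IsDoubling.isFiniteMeasure [CompactSpace Y] {μ : Measure Y} (hμ : IsDoubling μ) :
    IsFiniteMeasure μ := by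
  constructor
  rcases isEmpty_or_nonempty Y with hY | ⟨⟨x⟩⟩
  · simp [univ_eq_empty_iff.2 hY]
  · obtain ⟨R, hR⟩ := (isCompact_univ (X := Y)).isBounded.subset_ball x
    exact (measure_mono hR).trans_lt (hμ.measure_ball_lt_top x R)

/-- Balls of comparable radii whose centres are close on the same scale have comparable
measures. -/
theorem IsDoubling.exists_measure_ball_le {μ : Measure Y} (hμ : IsDoubling μ) (M : ℝ) :
    ∃ C : ℝ≥0∞, C ≠ ∞ ∧ ∀ (x y : Y) (r : ℝ), 0 < r → dist x y ≤ M * r →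
      μ (ball x (M * r)) ≤ C * μ (ball y r) := by
  obtain ⟨C, -, h⟩ := hμ
  obtain ⟨k, hk⟩ := pow_unbounded_of_one_lt (2 * M) (one_lt_two (α := ℝ))
  have key : ∀ (k : ℕ) (y : Y) (r : ℝ), 0 < r →
      μ (ball y (2 ^ k * r)) ≤ ENNReal.ofReal C ^ k * μ (ball y r) := by
    intro k y r hr
    induction k with
    | zero => simp
    | succ k ih =>
      calc μ (ball y (2 ^ (k + 1) * r)) = μ (ball y (2 * (2 ^ k * r))) := by
            rw [pow_succ']; ring_nf
        _ ≤ ENNReal.ofReal C * μ (ball y (2 ^ k * r)) := (h y _ (by positivity)).2.1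
        _ ≤ ENNReal.ofReal C * (ENNReal.ofReal C ^ k * μ (ball y r)) := by gcongr
        _ = _ := by rw [pow_succ']; ring
  refine ⟨ENNReal.ofReal C ^ k, by simp, fun x y r hr hxy => ?_⟩
  refine (measure_mono (ball_subset_ball' ?_)).trans (key k y r hr)
  nlinarith

theorem _root_.ENNReal.inv_le_mul_inv {a b C : ℝ≥0∞} (hb : b ≠ 0) (hb' : b ≠ ∞)
    (h : b ≤ C * a) : a⁻¹ ≤ C * b⁻¹ :=
  calc a⁻¹ = b⁻¹ * b * a⁻¹ := by rw [ENNReal.inv_mul_cancel hb hb', one_mul]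
    _ ≤ b⁻¹ * (C * a) * a⁻¹ := by gcongr
    _ = C * b⁻¹ * (a * a⁻¹) := by ring
    _ ≤ C * b⁻¹ * 1 := by gcongr; exact ENNReal.mul_inv_le_one a
    _ = C * b⁻¹ := mul_one _

/-- The mean value of `f` over a subset of comparable measure deviates from `c` by at most a
constant times the mean deviation over the whole set. -/
theorem enorm_setAverage_sub_le {X : Type*} [MeasurableSpace X] {μ : Measure X} {A B : Set X}
    (hAB : A ⊆ B) (hA : μ A ≠ 0) (hB : μ B ≠ ∞) {C : ℝ≥0∞} (h : μ B ≤ C * μ A)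
    {f : X → ℝ} (hf : IntegrableOn f A μ) (c : ℝ) :
    ‖(⨍ y in A, f y ∂μ) - c‖ₑ ≤ C * ⨍⁻ y in B, ‖f y - c‖ₑ ∂μ := by
  have hA' : μ A ≠ ∞ := ne_top_of_le_ne_top hB (measure_mono hAB)
  have hB0 : μ B ≠ 0 := fun h0 => hA (measure_mono_null hAB h0)
  have h1 : (⨍ y in A, f y ∂μ) - c = ⨍ y in A, (f y - c) ∂μ := by
    rw [setAverage_eq, setAverage_eq, integral_sub hf (integrableOn_const hA')]
    have : μ.real A ≠ 0 := (ENNReal.toReal_ne_zero).2 ⟨hA, hA'⟩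
    simp only [smul_eq_mul, setIntegral_const]
    field_simp
  have h2 : (μ A)⁻¹ ≤ C * (μ B)⁻¹ := ENNReal.inv_le_mul_inv hB0 hB h
  calc ‖(⨍ y in A, f y ∂μ) - c‖ₑ ≤ ⨍⁻ y in A, ‖f y - c‖ₑ ∂μ := by
        rw [h1]; exact enorm_integral_le_lintegral_enorm _
    _ = (μ A)⁻¹ * ∫⁻ y in A, ‖f y - c‖ₑ ∂μ := by rw [setLAverage_eq, ENNReal.div_eq_inv_mul]
    _ ≤ (C * (μ B)⁻¹) * ∫⁻ y in B, ‖f y - c‖ₑ ∂μ := by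
        gcongr
    _ = _ := by rw [setLAverage_eq, ENNReal.div_eq_inv_mul, mul_assoc]

/-- The Poincaré inequality with constants `A`, `l` for one fixed pair of functions. -/
def PoincarePair (p A l : ℝ) (μ : Measure Y) (v : Y → ℝ) (g : Y → ℝ≥0∞) : Prop :=
  ∀ (y : Y) (s : ℝ), 0 < s →
    ⨍⁻ z in ball y s, ‖v z - ⨍ w in ball y s, v w ∂μ‖ₑ ∂μ ≤
      ENNReal.ofReal (A * s) * (⨍⁻ z in ball y (l * s), g z ^ p ∂μ) ^ (1 / p)

/-- The weighted sum `∑ 2^{-iκ} ⨍_{B(y, 2^{-i} r)} h dμ` over dyadic scales below `r`. -/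
noncomputable def scaleSum (κ : ℝ) (μ : Measure Y) (h : Y → ℝ≥0∞) (r : ℝ) (y : Y) : ℝ≥0∞ :=
  ∑' i : ℕ, (2⁻¹ ^ i : ℝ≥0∞) ^ κ * ⨍⁻ z in ball y (2⁻¹ ^ i * r), h z ∂μ

theorem two_inv_rpow_lt_one {a : ℝ} (ha : 0 < a) : (2⁻¹ : ℝ≥0∞) ^ a < 1 :=
  ENNReal.rpow_lt_one (by simp) ha

theorem tsum_two_inv_rpow_ne_top {a : ℝ} (ha : 0 < a) :
    ∑' i : ℕ, ((2⁻¹ : ℝ≥0∞) ^ i) ^ a ≠ ∞ := by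
  have h : ∀ i : ℕ, ((2⁻¹ : ℝ≥0∞) ^ i) ^ a = ((2⁻¹ : ℝ≥0∞) ^ a) ^ i := fun i => by
    rw [← ENNReal.rpow_natCast, ← ENNReal.rpow_natCast, ← ENNReal.rpow_mul, ← ENNReal.rpow_mul,
      mul_comm]
  simp only [h, ENNReal.tsum_geometric]
  exact ENNReal.inv_ne_top.2 (tsub_pos_of_lt (two_inv_rpow_lt_one ha)).ne'

/-- A sum with geometric weights is controlled by the `p`-th root of a sum with slightly larger
geometric weights: split off a summable factor and bound each remaining term by the whole sum. -/
theorem tsum_two_inv_mul_rpow_le {p κ : ℝ} (hp : 0 < p) (b : ℕ → ℝ≥0∞) :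
    ∑' i : ℕ, 2⁻¹ ^ i * b i ^ (1 / p) ≤
      (∑' i : ℕ, ((2⁻¹ : ℝ≥0∞) ^ i) ^ (1 - κ / p)) *
        (∑' i : ℕ, (2⁻¹ ^ i : ℝ≥0∞) ^ κ * b i) ^ (1 / p) := by
  rw [← ENNReal.tsum_mul_right]
  refine ENNReal.tsum_le_tsum fun i => ?_
  have h0 : (2⁻¹ ^ i : ℝ≥0∞) ≠ 0 := by simp
  have h1 : (2⁻¹ ^ i : ℝ≥0∞) ≠ ∞ := by simp
  calc (2⁻¹ ^ i : ℝ≥0∞) * b i ^ (1 / p)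
      = (2⁻¹ ^ i : ℝ≥0∞) ^ (1 - κ / p) * ((2⁻¹ ^ i : ℝ≥0∞) ^ κ * b i) ^ (1 / p) := by
        rw [ENNReal.mul_rpow_of_nonneg _ _ (by positivity), ← ENNReal.rpow_mul, ← mul_assoc,
          ← ENNReal.rpow_add _ _ h0 h1]
        have : 1 - κ / p + κ * (1 / p) = 1 := by ring
        rw [this, ENNReal.rpow_one]
    _ ≤ _ := by
        gcongr
        exact ENNReal.le_tsum (f := fun i : ℕ => (2⁻¹ ^ i : ℝ≥0∞) ^ κ * b i) i

/-- The telescoping estimate: at a point where the averages of `v` over small balls tend to the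
value of `v`, the oscillation of `v` is controlled by averages of `g ^ p` over dyadic scales. -/
theorem exists_enorm_sub_average_rpow_le [OpensMeasurableSpace Y] {p κ A l : ℝ} (hp : 0 < p)
    (hκ : κ < p) (hA : 0 < A) (hl : 1 ≤ l) {μ : Measure Y} [IsFiniteMeasure μ]
    (hμ : IsDoubling μ) :
    ∃ C : ℝ≥0∞, C ≠ ∞ ∧ ∀ (v : Y → ℝ) (g : Y → ℝ≥0∞), Integrable v μ → PoincarePair p A l μ v g →
      ∀ (x y : Y) (r : ℝ), 0 < r → y ∈ ball x (2 * r) →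
        Tendsto (fun N : ℕ => ⨍ z in closedBall y (2⁻¹ ^ (N + 1) * (r / l)), v z ∂μ) atTop
          (𝓝 (v y)) →
        ‖v y - ⨍ z in ball x (4 * r), v z ∂μ‖ₑ ^ p ≤
          C * ENNReal.ofReal r ^ p *
            ((⨍⁻ z in ball x (l * (4 * r)), g z ^ p ∂μ) + scaleSum κ μ (fun z => g z ^ p) r y) := by
  obtain ⟨C₁, hC₁, hd₁⟩ := hμ.exists_measure_ball_le 2
  obtain ⟨C₂, hC₂, hd₂⟩ := hμ.exists_measure_ball_le (4 * l)
  set Z : ℝ≥0∞ := ∑' i : ℕ, ((2⁻¹ : ℝ≥0∞) ^ i) ^ (1 - κ / p) with hZ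
  have hZt : Z ≠ ∞ := tsum_two_inv_rpow_ne_top (by rw [sub_pos, div_lt_one hp]; exact hκ)
  refine ⟨(C₁ * Z * ENNReal.ofReal A + C₂ * ENNReal.ofReal (A * 4)) ^ p, ?_, ?_⟩
  · refine ENNReal.rpow_ne_top_of_nonneg hp.le ?_
    finiteness
  intro v g hv hP x y r hr hy hlim
  have hl0 : 0 < l := one_pos.trans_le hl
  set G : ℝ≥0∞ := ⨍⁻ z in ball x (l * (4 * r)), g z ^ p ∂μ with hG
  set S : ℝ≥0∞ := scaleSum κ μ (fun z => g z ^ p) r y with hS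
  -- the radii start at `r / l`, so that the balls enlarged by `l` have radius at most `r`
  set ρ : ℕ → ℝ := fun i => 2⁻¹ ^ i * (r / l) with hρ
  have hρ0 : ∀ i, 0 < ρ i := fun i => by positivity
  have hρs : ∀ i, 2 * ρ (i + 1) = ρ i := fun i => by simp only [hρ, pow_succ]; ring
  set m : ℕ → ℝ := fun i => ⨍ z in ball y (ρ i), v z ∂μ with hm
  set c : ℕ → ℝ≥0∞ := fun i => ENNReal.ofReal (A * r) *
    (2⁻¹ ^ i * (⨍⁻ z in ball y (2⁻¹ ^ i * r), g z ^ p ∂μ) ^ (1 / p)) with hc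
  have hpos : ∀ (z : Y) {s : ℝ}, 0 < s → μ (ball z s) ≠ 0 := fun z s hs =>
    (hμ.measure_ball_pos z hs).ne'
  have hosc : ∀ i, ⨍⁻ z in ball y (ρ i), ‖v z - m i‖ₑ ∂μ ≤ c i := by
    intro i
    refine (hP y (ρ i) (hρ0 i)).trans ?_
    have e1 : l * ρ i = 2⁻¹ ^ i * r := by simp only [hρ]; field_simp
    have e2 : (2⁻¹ ^ i : ℝ≥0∞) = ENNReal.ofReal (2⁻¹ ^ i) := by
      rw [ENNReal.ofReal_pow (by norm_num), ENNReal.ofReal_inv_of_pos (by norm_num)]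
      simp
    rw [e1, hc]
    simp only
    rw [e2, ← mul_assoc (ENNReal.ofReal _), ← ENNReal.ofReal_mul (p := A * r) (by positivity)]
    refine mul_le_mul_left (ENNReal.ofReal_le_ofReal ?_) _
    have : A * (2⁻¹ ^ i * (r / l)) = A * r * 2⁻¹ ^ i / l := by ring
    rw [this]
    exact div_le_self (by positivity) hl
  have hd₁' : ∀ i, μ (ball y (ρ i)) ≤ C₁ * μ (ball y (ρ (i + 1))) := fun i => by
    have := hd₁ y y (ρ (i + 1)) (hρ0 _) (by rw [dist_self]; linarith [hρ0 (i + 1)])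
    rwa [hρs] at this
  have hstep : ∀ i, ‖m (i + 1) - m i‖ₑ ≤ C₁ * c i := fun i =>
    (enorm_setAverage_sub_le (ball_subset_ball (by linarith [hρs i, hρ0 (i + 1)]))
      (hpos y (hρ0 _)) (measure_ne_top _ _) (hd₁' i) hv.integrableOn _).trans
      (mul_le_mul_right (hosc i) _)
  have hlast : ∀ i, ‖(⨍ z in closedBall y (ρ (i + 1)), v z ∂μ) - m i‖ₑ ≤ C₁ * c i := fun i =>
    (enorm_setAverage_sub_le (closedBall_subset_ball (by linarith [hρs i, hρ0 (i + 1)]))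
      (fun h => hpos y (hρ0 (i + 1)) (measure_mono_null ball_subset_closedBall h))
      (measure_ne_top _ _)
      ((hd₁' i).trans (by gcongr; exact ball_subset_closedBall)) hv.integrableOn _).trans
      (mul_le_mul_right (hosc i) _)
  have hfirst : ‖m 0 - ⨍ z in ball x (4 * r), v z ∂μ‖ₑ ≤
      C₂ * (ENNReal.ofReal (A * (4 * r)) * G ^ (1 / p)) := by
    have hρ00 : ρ 0 = r / l := by simp [hρ]
    have hrl : r / l ≤ r := div_le_self hr.le hl
    have hxy : dist y x < 2 * r := hy
    refine (enorm_setAverage_sub_le (B := ball x (4 * r)) (C := C₂) ?_ (hpos y (hρ0 0))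
      (measure_ne_top _ _) ?_ hv.integrableOn _).trans (mul_le_mul_right (hP x _ (by positivity)) _)
    · exact ball_subset_ball' (by linarith)
    · have e : 4 * l * (r / l) = 4 * r := by field_simp
      have := hd₂ x y (r / l) (by positivity) (by rw [e, dist_comm]; linarith)
      rwa [e, ← hρ00] at this
  have htel : ∀ N, ‖m N - m 0‖ₑ ≤ C₁ * ∑ i ∈ Finset.range N, c i := by
    intro N
    induction N with
    | zero => simp
    | succ N ih =>
      rw [Finset.sum_range_succ, mul_add, add_comm (C₁ * _)]
      calc ‖m (N + 1) - m 0‖ₑ = ‖(m (N + 1) - m N) + (m N - m 0)‖ₑ := by congr 1; ring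
        _ ≤ _ := (enorm_add_le _ _).trans (add_le_add (hstep N) ih)
  have hsum : ∀ N, ∑ i ∈ Finset.range N, c i ≤ ENNReal.ofReal (A * r) * (Z * S ^ (1 / p)) :=
    fun N => by
      refine (ENNReal.sum_le_tsum _).trans ?_
      rw [hc]
      simp only
      rw [ENNReal.tsum_mul_left]
      gcongr
      exact tsum_two_inv_mul_rpow_le hp _
  have hall : ∀ N : ℕ, ‖(⨍ z in closedBall y (ρ (N + 1)), v z ∂μ) -
      ⨍ z in ball x (4 * r), v z ∂μ‖ₑ ≤
        (C₁ * Z * ENNReal.ofReal A + C₂ * ENNReal.ofReal (A * 4)) * ENNReal.ofReal r *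
          (G + S) ^ (1 / p) := by
    intro N
    have e : ∀ a b c d : ℝ, a - d = (a - b) + (b - c) + (c - d) := fun a b c d => by ring
    rw [e _ (m N) (m 0) _]
    calc _ ≤ C₁ * c N + C₁ * ∑ i ∈ Finset.range N, c i +
          C₂ * (ENNReal.ofReal (A * (4 * r)) * G ^ (1 / p)) :=
          (enorm_add_le _ _).trans (add_le_add ((enorm_add_le _ _).trans
            (add_le_add (hlast N) (htel N))) hfirst)
      _ = C₁ * ∑ i ∈ Finset.range (N + 1), c i +
          C₂ * (ENNReal.ofReal (A * (4 * r)) * G ^ (1 / p)) := by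
          rw [Finset.sum_range_succ]; ring
      _ ≤ C₁ * (ENNReal.ofReal (A * r) * (Z * (G + S) ^ (1 / p))) +
          C₂ * (ENNReal.ofReal (A * (4 * r)) * (G + S) ^ (1 / p)) := by
          gcongr
          · refine (hsum _).trans ?_
            gcongr
            exact le_add_self
          · exact le_self_add
      _ = _ := by
          rw [← mul_assoc A 4 r, ENNReal.ofReal_mul hA.le,
            ENNReal.ofReal_mul (p := A * 4) (by positivity)]
          ring
  have hfin := le_of_tendsto ((hlim.sub_const (⨍ z in ball x (4 * r), v z ∂μ)).enorm)
    (Eventually.of_forall hall)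
  calc _ ≤ ((C₁ * Z * ENNReal.ofReal A + C₂ * ENNReal.ofReal (A * 4)) * ENNReal.ofReal r *
          (G + S) ^ (1 / p)) ^ p := by gcongr
    _ = _ := by
      rw [ENNReal.mul_rpow_of_nonneg _ _ hp.le, ENNReal.mul_rpow_of_nonneg _ _ hp.le,
        ← ENNReal.rpow_mul, one_div_mul_cancel hp.ne', ENNReal.rpow_one]

/-! ### Integrals of ball averages -/

section Averages

variable [SecondCountableTopology Y] [OpensMeasurableSpace Y]

theorem measurable_indicator_ball {h : Y → ℝ≥0∞} (hh : Measurable h) (s : ℝ) :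
    Measurable (fun q : Y × Y => (ball q.1 s).indicator h q.2) := by
  have : (fun q : Y × Y => (ball q.1 s).indicator h q.2) =
      {q : Y × Y | dist q.2 q.1 < s}.indicator (fun q => h q.2) := by
    ext q; simp [indicator, mem_ball]
  rw [this]
  exact (hh.comp measurable_snd).indicator
    (measurableSet_lt (measurable_snd.dist measurable_fst) measurable_const)

theorem measurable_setLIntegral_ball (μ : Measure Y) [SFinite μ] {h : Y → ℝ≥0∞}
    (hh : Measurable h) (s : ℝ) : Measurable (fun y => ∫⁻ z in ball y s, h z ∂μ) := by
  have := (measurable_indicator_ball hh s).lintegral_prod_right' (ν := μ)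
  simpa [lintegral_indicator measurableSet_ball] using this

theorem measurable_setLAverage_ball (μ : Measure Y) [SFinite μ] {h : Y → ℝ≥0∞}
    (hh : Measurable h) (s : ℝ) : Measurable (fun y => ⨍⁻ z in ball y s, h z ∂μ) := by
  simp only [setLAverage_eq]
  refine (measurable_setLIntegral_ball μ hh s).div ?_
  simpa using measurable_setLIntegral_ball μ (h := fun _ => 1) measurable_const s

/-- Integrating the averages of `h` over balls of a fixed radius `s` against a measure `σ` whose
mass on balls of radius `2s` is at most `D` times that of `μ` costs a factor `D`. -/
theorem lintegral_setLAverage_ball_le {μ σ : Measure Y} [IsFiniteMeasure μ] [IsFiniteMeasure σ]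
    (hμ : IsDoubling μ) {C D : ℝ≥0∞} {s : ℝ} (hs : 0 < s)
    (hC : ∀ x y : Y, dist x y ≤ 2 * s → μ (ball x (2 * s)) ≤ C * μ (ball y s))
    {A : Set Y} (hA : σ Aᶜ = 0) (hD : ∀ y ∈ A, σ (ball y (2 * s)) ≤ D * μ (ball y s))
    {h : Y → ℝ≥0∞} (hh : Measurable h) :
    ∫⁻ y, ⨍⁻ z in ball y s, h z ∂μ ∂σ ≤ C * D * ∫⁻ z, h z ∂μ := by
  have hm : Measurable (fun y : Y => (μ (ball y s))⁻¹) := by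
    have := (measurable_setLIntegral_ball μ (h := fun _ => 1) measurable_const s).inv
    simp only [setLIntegral_one] at this
    exact this
  have hpt : ∀ z, ∫⁻ y in ball z s, (μ (ball y s))⁻¹ ∂σ ≤ C * D := by
    intro z
    rcases (A ∩ ball z s).eq_empty_or_nonempty with h0 | ⟨y₀, hy₀A, hy₀⟩
    · have : σ (ball z s) = 0 := measure_mono_null
        (fun y hy hyA => (h0 ▸ (⟨hyA, hy⟩ : y ∈ A ∩ ball z s) : y ∈ (∅ : Set Y))) hA
      simp [Measure.restrict_eq_zero.2 this]
    · have hpos := (hμ.measure_ball_pos y₀ hs).ne'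
      have hfin := measure_ne_top μ (ball y₀ s)
      have hb : ∀ y ∈ ball z s, (μ (ball y s))⁻¹ ≤ C * (μ (ball y₀ s))⁻¹ := by
        intro y hy
        have hd : dist y₀ y ≤ 2 * s := by
          have := dist_triangle_right y₀ y z
          rw [mem_ball] at hy hy₀
          linarith
        have h1 : μ (ball y₀ s) ≤ C * μ (ball y s) :=
          (measure_mono (ball_subset_ball (by linarith))).trans (hC y₀ y hd)
        exact ENNReal.inv_le_mul_inv hpos hfin h1
      calc ∫⁻ y in ball z s, (μ (ball y s))⁻¹ ∂σ
          ≤ ∫⁻ _ in ball z s, C * (μ (ball y₀ s))⁻¹ ∂σ := setLIntegral_mono measurable_const hb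
        _ = C * (μ (ball y₀ s))⁻¹ * σ (ball z s) := by simp
        _ ≤ C * (μ (ball y₀ s))⁻¹ * (D * μ (ball y₀ s)) := by
            gcongr
            refine (measure_mono (ball_subset_ball' ?_)).trans (hD y₀ hy₀A)
            rw [mem_ball, dist_comm] at hy₀
            linarith
        _ = C * D * ((μ (ball y₀ s))⁻¹ * μ (ball y₀ s)) := by ring
        _ = C * D := by rw [ENNReal.inv_mul_cancel hpos hfin, mul_one]
  calc ∫⁻ y, ⨍⁻ z in ball y s, h z ∂μ ∂σ
      = ∫⁻ y, ∫⁻ z, (μ (ball y s))⁻¹ * (ball y s).indicator h z ∂μ ∂σ := by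
        refine lintegral_congr fun y => ?_
        rw [setLAverage_eq, ENNReal.div_eq_inv_mul, lintegral_const_mul _
          (hh.indicator measurableSet_ball), lintegral_indicator measurableSet_ball]
    _ = ∫⁻ z, ∫⁻ y, (μ (ball y s))⁻¹ * (ball y s).indicator h z ∂σ ∂μ := by
        refine lintegral_lintegral_swap (Measurable.aemeasurable ?_)
        exact (hm.comp measurable_fst).mul (measurable_indicator_ball hh s)
    _ = ∫⁻ z, (∫⁻ y in ball z s, (μ (ball y s))⁻¹ ∂σ) * h z ∂μ := by
        refine lintegral_congr fun z => ?_
        rw [← lintegral_mul_const _ hm, ← lintegral_indicator measurableSet_ball]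
        refine lintegral_congr fun y => ?_
        by_cases hyz : dist y z < s
        · rw [indicator_of_mem (by rwa [mem_ball, dist_comm]), indicator_of_mem (by rwa [mem_ball])]
        · rw [indicator_of_notMem (by rwa [mem_ball, dist_comm]),
            indicator_of_notMem (by rwa [mem_ball]), mul_zero]
    _ ≤ ∫⁻ z, C * D * h z ∂μ := lintegral_mono fun z => by gcongr; exact hpt z
    _ = _ := lintegral_const_mul _ hh

/-- Integrating the right-hand side of the telescoping estimate against a measure of
codimension `Θ < κ`. -/
theorem exists_lintegral_scaleSum_le {κ Θ l : ℝ} (hΘ : Θ < κ) (hl : 1 ≤ l) {μ : Measure Y}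
    [IsFiniteMeasure μ] (hμ : IsDoubling μ) :
    ∃ C : ℝ≥0∞, C ≠ ∞ ∧ ∀ (σ : Measure Y) [IsFiniteMeasure σ] (D : ℝ≥0∞) (A : Set Y) (x : Y)
      (r : ℝ) (h : Y → ℝ≥0∞), Measurable h → 0 < r → σ Aᶜ = 0 →
      σ univ ≤ D * ENNReal.ofReal r ^ (-Θ) * μ (ball x r) →
      (∀ y ∈ A, ∀ s, 0 < s → s ≤ r →
        σ (ball y (2 * s)) ≤ D * ENNReal.ofReal s ^ (-Θ) * μ (ball y s)) →
      ∫⁻ y, ((⨍⁻ z in ball x (l * (4 * r)), h z ∂μ) + scaleSum κ μ h r y) ∂σ ≤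
        C * D * ENNReal.ofReal r ^ (-Θ) * ∫⁻ z, h z ∂μ := by
  obtain ⟨C₁, hC₁, hd₁⟩ := hμ.exists_measure_ball_le 2
  set Z : ℝ≥0∞ := ∑' i : ℕ, ((2⁻¹ : ℝ≥0∞) ^ i) ^ (κ - Θ) with hZ
  have hZt : Z ≠ ∞ := tsum_two_inv_rpow_ne_top (by linarith)
  refine ⟨1 + C₁ * Z, by finiteness, ?_⟩
  intro σ _ D A x r h hh hr hσA hσ hD
  rw [lintegral_add_left measurable_const]
  have h1 : ∫⁻ _, (⨍⁻ z in ball x (l * (4 * r)), h z ∂μ) ∂σ ≤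
      D * ENNReal.ofReal r ^ (-Θ) * ∫⁻ z, h z ∂μ := by
    have hr' : r ≤ l * (4 * r) := by nlinarith
    have hpos := (hμ.measure_ball_pos x (hr.trans_le hr')).ne'
    rw [lintegral_const, setLAverage_eq]
    calc _ ≤ (∫⁻ z, h z ∂μ) / μ (ball x (l * (4 * r))) *
          (D * ENNReal.ofReal r ^ (-Θ) * μ (ball x (l * (4 * r)))) := by
          gcongr
          · exact Measure.restrict_le_self
          · refine hσ.trans ?_
            gcongr
      _ = D * ENNReal.ofReal r ^ (-Θ) * ((∫⁻ z, h z ∂μ) / μ (ball x (l * (4 * r))) *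
          μ (ball x (l * (4 * r)))) := by ring
      _ = _ := by rw [ENNReal.div_mul_cancel hpos (measure_ne_top _ _)]
  have h2 : ∫⁻ y, scaleSum κ μ h r y ∂σ ≤
      C₁ * Z * (D * ENNReal.ofReal r ^ (-Θ) * ∫⁻ z, h z ∂μ) := by
    simp only [scaleSum]
    rw [lintegral_tsum fun i =>
      ((measurable_setLAverage_ball μ hh _).const_mul _).aemeasurable]
    calc _ ≤ ∑' i : ℕ, ((2⁻¹ : ℝ≥0∞) ^ i) ^ (κ - Θ) *
          (C₁ * (D * ENNReal.ofReal r ^ (-Θ) * ∫⁻ z, h z ∂μ)) := by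
          refine ENNReal.tsum_le_tsum fun i => ?_
          have hs : (0 : ℝ) < 2⁻¹ ^ i * r := by positivity
          have hsr : (2⁻¹ : ℝ) ^ i * r ≤ r :=
            mul_le_of_le_one_left hr.le (pow_le_one₀ (by norm_num) (by norm_num))
          have e0 : (2⁻¹ ^ i : ℝ≥0∞) = ENNReal.ofReal (2⁻¹ ^ i) := by
            rw [ENNReal.ofReal_pow (by norm_num), ENNReal.ofReal_inv_of_pos (by norm_num)]
            simp
          rw [lintegral_const_mul _ (measurable_setLAverage_ball μ hh _)]
          calc _ ≤ (2⁻¹ ^ i : ℝ≥0∞) ^ κ * (C₁ * (D * ENNReal.ofReal (2⁻¹ ^ i * r) ^ (-Θ)) *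
                ∫⁻ z, h z ∂μ) := by
                gcongr
                exact lintegral_setLAverage_ball_le hμ hs (fun x y => hd₁ x y _ hs) hσA
                  (fun y hy => hD y hy _ hs hsr) hh
            _ = _ := by
                rw [ENNReal.ofReal_mul (by positivity), ← e0, ENNReal.mul_rpow_of_ne_top
                  (by simp) (by simp), sub_eq_add_neg κ Θ, ENNReal.rpow_add _ _ (by simp) (by simp)]
                ring
      _ = _ := by rw [ENNReal.tsum_mul_right]; ring
  calc _ ≤ _ := add_le_add h1 h2
    _ = _ := by ring

end Averages

/-! ### A Maz'ya type inequality -/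

theorem IsDoubling.isUnifLocDoublingMeasure {μ : Measure Y} (hμ : IsDoubling μ) :
    IsUnifLocDoublingMeasure μ := by
  obtain ⟨C, hC, h⟩ := hμ.exists_measure_ball_le 4
  refine ⟨⟨C.toNNReal, ?_⟩⟩
  filter_upwards [self_mem_nhdsWithin] with ε hε x
  have hε : 0 < ε := hε
  rw [ENNReal.coe_toNNReal hC]
  calc μ (closedBall x (2 * ε)) ≤ μ (ball x (4 * ε)) :=
        measure_mono (closedBall_subset_ball (by linarith))
    _ ≤ C * μ (ball x ε) := h x x ε hε (by rw [dist_self]; positivity)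
    _ ≤ C * μ (closedBall x ε) := by gcongr; exact ball_subset_closedBall

theorem tendsto_two_inv_pow_succ_mul {ρ : ℝ} (hρ : 0 < ρ) :
    Tendsto (fun N : ℕ => (2⁻¹ : ℝ) ^ (N + 1) * ρ) atTop (𝓝[>] 0) := by
  refine tendsto_nhdsWithin_iff.2 ⟨?_, Eventually.of_forall fun N => by
    simp only [mem_Ioi]; positivity⟩
  have := ((tendsto_pow_atTop_nhds_zero_of_lt_one (r := (2⁻¹ : ℝ)) (by norm_num)
    (by norm_num)).comp (tendsto_add_atTop_nat 1)).mul_const ρ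
  simpa using this

theorem tendsto_average_closedBall_of_continuousAt [OpensMeasurableSpace Y] {μ : Measure Y}
    [IsFiniteMeasure μ] (hμ : IsDoubling μ) {v : Y → ℝ} (hv : Integrable v μ) {y : Y}
    (hc : ContinuousAt v y) {ρ : ℝ} (hρ : 0 < ρ) :
    Tendsto (fun N : ℕ => ⨍ z in closedBall y (2⁻¹ ^ (N + 1) * ρ), v z ∂μ) atTop (𝓝 (v y)) := by
  rw [Metric.tendsto_nhds]
  intro ε hε
  obtain ⟨δ, hδ, h⟩ := Metric.continuousAt_iff.1 hc (ε / 2) (by positivity)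
  have ht := tendsto_two_inv_pow_succ_mul hρ
  filter_upwards [(tendsto_nhdsWithin_iff.1 ht).1.eventually (gt_mem_nhds hδ),
    (tendsto_nhdsWithin_iff.1 ht).2] with N hN hN0
  have hN0 : (0 : ℝ) < 2⁻¹ ^ (N + 1) * ρ := hN0
  have := Convex.set_average_mem (μ := μ) (t := closedBall y (2⁻¹ ^ (N + 1) * ρ))
    (convex_closedBall (v y) (ε / 2)) isClosed_closedBall
    (fun h0 => (hμ.measure_ball_pos y hN0).ne' (measure_mono_null ball_subset_closedBall h0))
    (measure_ne_top _ _)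
    ((ae_restrict_iff' measurableSet_closedBall).2 (Eventually.of_forall fun z hz =>
      mem_closedBall.2 (h ((mem_closedBall.1 hz).trans_lt hN)).le)) hv.integrableOn
  exact (mem_closedBall.1 this).trans_lt (by linarith)

/-- A Maz'ya type inequality: if `v = 1` on a piece of the codimension `Θ < p` set `E`, then the
`L^p` distance of `v` from `1` on a ball of radius `2r` is controlled by the `L^p` norm of `g`. -/
theorem exists_setLIntegral_one_sub_rpow_le [SecondCountableTopology Y] [BorelSpace Y]
    {p Θ A l : ℝ} (hp : 1 < p) (hΘ : 0 < Θ) (hΘp : Θ < p) (hA : 0 < A) (hl : 1 ≤ l)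
    {μ : Measure Y} [IsFiniteMeasure μ] (hμ : IsDoubling μ) {E : Set Y} (hE : IsClosed E)
    {ν : Measure Y} (hν : IsCodimensional Θ μ ν E) :
    ∃ C : ℝ≥0∞, C ≠ ∞ ∧ ∀ (v : Y → ℝ) (g : Y → ℝ≥0∞), LowerSemicontinuous v →
      (∀ y, 0 ≤ v y) → (∀ y, v y ≤ 1) → Measurable g → PoincarePair p A l μ v g →
      ∀ x ∈ E, ∀ r : ℝ, 0 < r → r < diam E / 4 → (∀ y ∈ closedBall x r ∩ E, v y = 1) →
        ∫⁻ y in ball x (2 * r), ‖1 - v y‖ₑ ^ p ∂μ ≤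
          C * ENNReal.ofReal r ^ p * ∫⁻ y, g y ^ p ∂μ := by
  have hp0 : 0 < p := by linarith
  obtain ⟨hνE, C₀, hC₀, hν⟩ := hν
  -- the weights must beat the factors `2^{iΘ}` from the codimension and still leave room below `p`
  set κ := (Θ + p) / 2 with hκ
  obtain ⟨C₁, hC₁, hpt⟩ := exists_enorm_sub_average_rpow_le (κ := κ) hp0 (by linarith) hA hl hμ
  obtain ⟨C₂, hC₂, hint⟩ := exists_lintegral_scaleSum_le (κ := κ) (Θ := Θ) (by linarith) hl hμ
  obtain ⟨C₃, hC₃, hint'⟩ := exists_lintegral_scaleSum_le (κ := κ) (Θ := 0) (by linarith) hl hμ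
  obtain ⟨C₄, hC₄, hd⟩ := hμ.exists_measure_ball_le 2
  have hd' : ∀ (y : Y) (s : ℝ), 0 < s → μ (ball y (2 * s)) ≤ C₄ * μ (ball y s) := fun y s hs =>
    hd y y s hs (by rw [dist_self]; positivity)
  set D := ENNReal.ofReal C₀ * C₄ with hD
  have hC₀' : 0 < C₀ := by linarith
  refine ⟨2 ^ (p - 1) * (ENNReal.ofReal C₀ * C₁ * C₂ * D * C₄ + C₁ * C₃ * C₄), ?_, ?_⟩
  · have : (2 : ℝ≥0∞) ^ (p - 1) ≠ ∞ := ENNReal.rpow_ne_top_of_nonneg (by linarith) (by simp)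
    finiteness
  intro v g hvl hv0 hv1 hg hP x hx r hr hrE hvK
  have hvm : Measurable v := hvl.measurable
  have hvb : ∀ y, ‖v y‖ ≤ 1 := fun y => by
    rw [Real.norm_eq_abs, abs_of_nonneg (hv0 y)]; exact hv1 y
  have hvi : Integrable v μ := Integrable.of_bound hvm.aestronglyMeasurable 1
    (Eventually.of_forall hvb)
  have hgp : Measurable (fun y => g y ^ p) := hg.pow_const p
  set I := ∫⁻ y, g y ^ p ∂μ with hI
  set m := ⨍ z in ball x (4 * r), v z ∂μ with hm
  set R := ENNReal.ofReal r with hR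
  set K := closedBall x r ∩ E with hK
  have hKm : MeasurableSet K := isClosed_closedBall.measurableSet.inter hE.measurableSet
  have hR0 : R ≠ 0 := by simpa [hR] using hr
  have hRt : R ≠ ∞ := ENNReal.ofReal_ne_top
  have hRp : R ^ p ≠ ∞ := ENNReal.rpow_ne_top_of_nonneg hp0.le hRt
  have hKb : closedBall x r ⊆ ball x (2 * r) := closedBall_subset_ball (by linarith)
  have hρ : 0 < r / l := by positivity
  -- the upper codimension bound
  have hup : ∀ y ∈ E, ∀ s, 0 < s → s ≤ r →
      ν (ball y (2 * s)) ≤ D * ENNReal.ofReal s ^ (-Θ) * μ (ball y s) := by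
    intro y hy s hs hsr
    calc ν (ball y (2 * s))
        ≤ ENNReal.ofReal C₀ * (μ (ball y (2 * s)) / ENNReal.ofReal ((2 * s) ^ Θ)) :=
          (hν y hy (2 * s) (by positivity) (by linarith)).2
      _ ≤ ENNReal.ofReal C₀ * ((C₄ * μ (ball y s)) / ENNReal.ofReal (s ^ Θ)) := by
          gcongr
          · exact hd' y s hs
          · linarith
      _ = _ := by
          rw [← ENNReal.ofReal_rpow_of_pos hs, ENNReal.rpow_neg, div_eq_mul_inv]
          ring
  have hνK : ν K ≤ D * R ^ (-Θ) * μ (ball x r) :=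
    (measure_mono (inter_subset_left.trans hKb)).trans (hup x hx r hr le_rfl)
  have hνKt : ν K ≠ ∞ := by
    refine ne_top_of_le_ne_top ?_ hνK
    have : R ^ (-Θ) ≠ ∞ := by simp [ENNReal.rpow_eq_top_iff, hR0, hRt]
    finiteness
  -- the set where `v = 1` forces the mean value of `v` to be close to `1`
  have hmean : ‖1 - m‖ₑ ^ p * μ (ball x r) ≤ ENNReal.ofReal C₀ * C₁ * C₂ * D * R ^ p * I := by
    have : IsFiniteMeasure (ν.restrict K) := ⟨by simpa using hνKt.lt_top⟩
    have h1 := hint (ν.restrict K) D K x r _ hgp hr (by simp [Measure.restrict_apply hKm.compl])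
      (by simpa using hνK) (fun y hy s hs hsr =>
        (Measure.restrict_apply_le _ _).trans (hup y hy.2 s hs hsr))
    have h2 : ‖1 - m‖ₑ ^ p * ν K ≤ C₁ * R ^ p * (C₂ * D * R ^ (-Θ) * I) := by
      calc ‖1 - m‖ₑ ^ p * ν K = ∫⁻ _ in K, ‖1 - m‖ₑ ^ p ∂ν := by simp
        _ ≤ ∫⁻ y in K, C₁ * R ^ p * ((⨍⁻ z in ball x (l * (4 * r)), g z ^ p ∂μ) +
              scaleSum κ μ (fun z => g z ^ p) r y) ∂ν := by
            refine setLIntegral_mono' hKm fun y hy => ?_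
            -- `v` is lower semicontinuous and attains its maximum at `y`
            have hcont : ContinuousAt v y := by
              rw [continuousAt_iff_lower_upperSemicontinuousAt]
              refine ⟨hvl y, fun c (hc : v y < c) => Eventually.of_forall fun z => ?_⟩
              rw [hvK y hy] at hc
              exact (hv1 z).trans_lt hc
            have := hpt v g hvi hP x y r hr (hKb hy.1)
              (tendsto_average_closedBall_of_continuousAt hμ hvi hcont hρ)
            rwa [hvK y hy] at this
        _ = C₁ * R ^ p * ∫⁻ y in K, ((⨍⁻ z in ball x (l * (4 * r)), g z ^ p ∂μ) +
              scaleSum κ μ (fun z => g z ^ p) r y) ∂ν :=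
            lintegral_const_mul' _ _ (by finiteness)
        _ ≤ _ := by gcongr
    have h3 : ENNReal.ofReal (1 / C₀) * (μ (ball x r) * R ^ (-Θ)) ≤ ν K := by
      have h4 : ν (ball x r) ≤ ν K := by
        calc ν (ball x r) ≤ ν (K ∪ Eᶜ) := measure_mono fun y hy => by
              by_cases hyE : y ∈ E
              · exact Or.inl ⟨ball_subset_closedBall hy, hyE⟩
              · exact Or.inr hyE
          _ ≤ ν K + ν Eᶜ := measure_union_le _ _
          _ = ν K := by rw [hνE, add_zero]
      refine le_trans ?_ ((hν x hx r hr (by linarith)).1.trans h4)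
      rw [← ENNReal.ofReal_rpow_of_pos hr, ENNReal.rpow_neg, ← div_eq_mul_inv (μ (ball x r))]
    have hRΘ : R ^ Θ * R ^ (-Θ) = 1 := by
      rw [← ENNReal.rpow_add _ _ hR0 hRt, add_neg_cancel, ENNReal.rpow_zero]
    have hCC : ENNReal.ofReal C₀ * ENNReal.ofReal (1 / C₀) = 1 := by
      rw [← ENNReal.ofReal_mul hC₀'.le, mul_one_div_cancel hC₀'.ne', ENNReal.ofReal_one]
    calc ‖1 - m‖ₑ ^ p * μ (ball x r)
        = (ENNReal.ofReal C₀ * ENNReal.ofReal (1 / C₀)) * (R ^ Θ * R ^ (-Θ)) *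
            (‖1 - m‖ₑ ^ p * μ (ball x r)) := by rw [hCC, hRΘ, one_mul, one_mul]
      _ = ENNReal.ofReal C₀ * R ^ Θ *
            (‖1 - m‖ₑ ^ p * (ENNReal.ofReal (1 / C₀) * (μ (ball x r) * R ^ (-Θ)))) := by ring
      _ ≤ ENNReal.ofReal C₀ * R ^ Θ * (C₁ * R ^ p * (C₂ * D * R ^ (-Θ) * I)) := by
          exact mul_le_mul_right ((mul_le_mul_right h3 _).trans h2) _
      _ = ENNReal.ofReal C₀ * C₁ * C₂ * D * R ^ p * I * (R ^ Θ * R ^ (-Θ)) := by ring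
      _ = _ := by rw [hRΘ, mul_one]
  -- the oscillation of `v` around that mean value; with respect to itself `μ` has codimension `0`
  have hosc : ∫⁻ y in ball x (2 * r), ‖v y - m‖ₑ ^ p ∂μ ≤ C₁ * C₃ * C₄ * R ^ p * I := by
    have h1 := hint' (μ.restrict (ball x (2 * r))) C₄ (ball x (2 * r)) x r _ hgp hr
      (by simp [Measure.restrict_apply measurableSet_ball.compl])
      (by simpa using hd' x r hr)
      (fun y hy s hs hsr => (Measure.restrict_apply_le _ _).trans (by simpa using hd' y s hs))
    have := hμ.isUnifLocDoublingMeasure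
    have hae : ∀ᵐ y ∂μ, Tendsto
        (fun N : ℕ => ⨍ z in closedBall y (2⁻¹ ^ (N + 1) * (r / l)), v z ∂μ) atTop (𝓝 (v y)) := by
      filter_upwards [IsUnifLocDoublingMeasure.ae_tendsto_average μ hvi.locallyIntegrable 1]
        with y h
      refine h (fun _ => y) _ (tendsto_two_inv_pow_succ_mul hρ) (Eventually.of_forall fun N => ?_)
      rw [one_mul]
      exact mem_closedBall_self (by positivity)
    calc _ ≤ ∫⁻ y in ball x (2 * r), C₁ * R ^ p *
            ((⨍⁻ z in ball x (l * (4 * r)), g z ^ p ∂μ) +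
              scaleSum κ μ (fun z => g z ^ p) r y) ∂μ := by
          refine lintegral_mono_ae ?_
          filter_upwards [ae_restrict_of_ae hae, ae_restrict_mem measurableSet_ball] with y hy hyb
          exact hpt v g hvi hP x y r hr hyb hy
      _ = C₁ * R ^ p * ∫⁻ y in ball x (2 * r), ((⨍⁻ z in ball x (l * (4 * r)), g z ^ p ∂μ) +
              scaleSum κ μ (fun z => g z ^ p) r y) ∂μ :=
          lintegral_const_mul' _ _ (by finiteness)
      _ ≤ C₁ * R ^ p * (C₃ * C₄ * R ^ (-0 : ℝ) * I) := by gcongr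
      _ = _ := by rw [neg_zero, ENNReal.rpow_zero]; ring
  calc ∫⁻ y in ball x (2 * r), ‖1 - v y‖ₑ ^ p ∂μ
      ≤ ∫⁻ y in ball x (2 * r), 2 ^ (p - 1) * (‖1 - m‖ₑ ^ p + ‖v y - m‖ₑ ^ p) ∂μ := by
        refine lintegral_mono fun y => ?_
        refine le_trans ?_ (ENNReal.rpow_add_le_mul_rpow_add_rpow _ _ hp.le)
        gcongr
        have : (1 - v y) = (1 - m) - (v y - m) := by ring
        rw [this]
        exact enorm_sub_le
    _ = 2 ^ (p - 1) * (‖1 - m‖ₑ ^ p * μ (ball x (2 * r)) +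
          ∫⁻ y in ball x (2 * r), ‖v y - m‖ₑ ^ p ∂μ) := by
        rw [lintegral_const_mul' _ _
          (ENNReal.rpow_ne_top_of_nonneg (by linarith) (by simp)), lintegral_add_left
          measurable_const]
        simp
    _ ≤ 2 ^ (p - 1) * (‖1 - m‖ₑ ^ p * (C₄ * μ (ball x r)) + C₁ * C₃ * C₄ * R ^ p * I) := by
        gcongr
        exact hd' x r hr
    _ = 2 ^ (p - 1) * (C₄ * (‖1 - m‖ₑ ^ p * μ (ball x r)) + C₁ * C₃ * C₄ * R ^ p * I) := by ring
    _ ≤ 2 ^ (p - 1) * (C₄ * (ENNReal.ofReal C₀ * C₁ * C₂ * D * R ^ p * I) +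
          C₁ * C₃ * C₄ * R ^ p * I) := by gcongr
    _ = _ := by ring

/-! ### Upper gradients along `1`-Lipschitz curves -/

theorem _root_.HasUnitSpeedOn.exists_lipschitzWith {X : Type*} [PseudoEMetricSpace X] {γ : ℝ → X}
    {L : ℝ} (hL : 0 ≤ L) (hγ : HasUnitSpeedOn γ (Icc 0 L)) :
    ∃ η : ℝ → X, LipschitzWith 1 η ∧ EqOn η γ (Icc 0 L) := by
  have h : LipschitzOnWith 1 γ (Icc 0 L) := by
    have key : ∀ s ∈ Icc 0 L, ∀ t ∈ Icc 0 L, s ≤ t → edist (γ s) (γ t) ≤ edist s t := by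
      intro s hs t ht hst
      calc edist (γ s) (γ t) ≤ eVariationOn γ (Icc 0 L ∩ Icc s t) :=
            eVariationOn.edist_le _ ⟨hs, left_mem_Icc.2 hst⟩ ⟨ht, right_mem_Icc.2 hst⟩
        _ = edist s t := by
            rw [hγ hs ht, NNReal.coe_one, one_mul, edist_comm, edist_dist, Real.dist_eq,
              abs_of_nonneg (sub_nonneg.2 hst)]
    intro s hs t ht
    rw [ENNReal.coe_one, one_mul]
    rcases le_total s t with hst | hst
    · exact key s hs t ht hst
    · rw [edist_comm, edist_comm s t]
      exact key t ht s hs hst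
  refine ⟨fun t => γ (projIcc 0 L hL t), fun s t => ?_, fun t ht => ?_⟩
  · refine (h (projIcc 0 L hL s).2 (projIcc 0 L hL t).2).trans ?_
    rw [ENNReal.coe_one, one_mul]
    exact (LipschitzWith.projIcc hL).edist_le_mul s t |>.trans (by simp)
  · simp only [projIcc_of_mem hL ht]

/-- Every `1`-Lipschitz curve with distinct end points can be reparametrized by arc length, and
this does not increase the integral of any nonnegative function. -/
theorem _root_.LipschitzWith.exists_hasUnitSpeedOn {X : Type*} [MetricSpace X] {γ : ℝ → X}
    (hγ : LipschitzWith 1 γ) {T : ℝ} (hT : 0 ≤ T) (hne : γ 0 ≠ γ T) :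
    ∃ (L : ℝ) (η : ℝ → X), 0 < L ∧ HasUnitSpeedOn η (Icc 0 L) ∧ η 0 = γ 0 ∧ η L = γ T ∧
      ∀ g : X → ℝ≥0∞, ∫⁻ t in Icc 0 L, g (η t) ≤ ∫⁻ t in Icc 0 T, g (γ t) := by
  have hbv := hγ.locallyBoundedVariationOn univ
  set φ : ℝ → ℝ := variationOnFromTo γ univ 0 with hφ
  set η : ℝ → X := naturalParameterization γ univ 0 with hη
  have hηφ : ∀ t, η (φ t) = γ t := fun t =>
    edist_eq_zero.1 (edist_naturalParameterization_eq_zero hbv (mem_univ 0) (mem_univ t))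
  have hφ0 : φ 0 = 0 := variationOnFromTo.self _ _ _
  have hmono : Monotone φ := monotoneOn_univ.1 (variationOnFromTo.monotoneOn hbv (mem_univ 0))
  have hlip : LipschitzWith 1 φ := by
    refine LipschitzWith.of_le_add_mul 1 fun s t => ?_
    rw [NNReal.coe_one, one_mul]
    rcases le_total s t with hst | hst
    · linarith [hmono hst, dist_nonneg (x := s) (y := t)]
    · have h1 : φ t + variationOnFromTo γ univ t s = φ s :=
        variationOnFromTo.add hbv (mem_univ _) (mem_univ _) (mem_univ _)
      have h2 : variationOnFromTo γ univ t s ≤ s - t := by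
        rw [variationOnFromTo.eq_of_le _ _ hst]
        refine ENNReal.toReal_le_of_le_ofReal (sub_nonneg.2 hst) ?_
        have := (hγ.lipschitzOnWith (s := univ)).comp_eVariationOn_le (g := id)
          (s := univ ∩ Icc t s) (fun _ _ => mem_univ _)
        refine this.trans ?_
        rw [ENNReal.coe_one, one_mul]
        exact (monotoneOn_id.eVariationOn_eq (mem_univ t) (mem_univ s)).le
      rw [Real.dist_eq, abs_of_nonneg (sub_nonneg.2 hst)]
      linarith
  have hL0 : 0 ≤ φ T := hφ0 ▸ hmono hT
  have hsurj : Icc 0 (φ T) ⊆ φ '' Icc 0 T := by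
    have := intermediate_value_Icc hT hlip.continuous.continuousOn
    rwa [hφ0] at this
  refine ⟨φ T, η, hL0.lt_of_ne fun h => hne ?_, ?_, ?_, hηφ T, fun g => ?_⟩
  · rw [← hηφ 0, ← hηφ T, hφ0, ← h]
  · have hu := has_unit_speed_naturalParameterization γ hbv (mem_univ 0)
    intro a ha b hb
    have hsub : Icc 0 (φ T) ⊆ φ '' univ := hsurj.trans (image_mono (subset_univ _))
    have := hu (hsub ha) (hsub hb)
    rw [← this]
    congr 1
    have hab : Icc a b ⊆ Icc 0 (φ T) := Icc_subset_Icc ha.1 hb.2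
    rw [inter_eq_self_of_subset_right hab, inter_eq_self_of_subset_right (hab.trans hsub)]
  · have := hηφ 0
    rwa [hφ0] at this
  -- Lebesgue measure on the image is dominated by the image of Lebesgue measure
  · have hle : (volume.restrict (Icc 0 (φ T)) : Measure ℝ) ≤
        Measure.map φ (volume.restrict (Icc 0 T)) := by
      refine Measure.le_iff.2 fun B hB => ?_
      rw [Measure.restrict_apply hB, Measure.map_apply hlip.continuous.measurable hB,
        Measure.restrict_apply (hlip.continuous.measurable hB)]
      have hsub : B ∩ Icc 0 (φ T) ⊆ φ '' (φ ⁻¹' B ∩ Icc 0 T) := by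
        rintro b ⟨hbB, hb⟩
        obtain ⟨t, ht, rfl⟩ := hsurj hb
        exact ⟨t, ⟨hbB, ht⟩, rfl⟩
      refine (measure_mono hsub).trans ?_
      have := (hlip.lipschitzOnWith (s := φ ⁻¹' B ∩ Icc 0 T)).hausdorffMeasure_image_le
        (zero_le_one (α := ℝ))
      simpa [hausdorffMeasure_real] using this
    calc ∫⁻ t in Icc 0 (φ T), g (η t)
        ≤ ∫⁻ t, g (η t) ∂(Measure.map φ (volume.restrict (Icc 0 T))) := lintegral_mono' hle le_rfl
      _ ≤ ∫⁻ t in Icc 0 T, g (η (φ t)) := lintegral_map_le _ _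
      _ = _ := by simp only [hηφ]

/-- The upper gradient inequality, stated for unit speed curves only, holds along all
`1`-Lipschitz curves. -/
theorem IsUpperGradient.ofReal_abs_sub_le {g : Y → ℝ≥0∞} {u : Y → ℝ} (h : IsUpperGradient g u)
    {γ : ℝ → Y} (hγ : LipschitzWith 1 γ) {T : ℝ} (hT : 0 ≤ T) :
    ENNReal.ofReal |u (γ 0) - u (γ T)| ≤ ∫⁻ t in Icc 0 T, g (γ t) := by
  by_cases hne : γ 0 = γ T
  · simp [hne]
  · obtain ⟨L, η, hL, hη, h0, h1, hle⟩ := hγ.exists_hasUnitSpeedOn hT hne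
    rw [← h0, ← h1]
    exact (h.2 L η hL hη).trans (hle g)

/-- The upper gradient inequality may be verified along `1`-Lipschitz curves defined on the whole
line instead of unit speed curves. -/
theorem isUpperGradient_of_lipschitzWith {g : Y → ℝ≥0∞} {u : Y → ℝ} (hg : Measurable g)
    (h : ∀ γ : ℝ → Y, LipschitzWith 1 γ → ∀ T, 0 ≤ T →
      ENNReal.ofReal |u (γ 0) - u (γ T)| ≤ ∫⁻ t in Icc 0 T, g (γ t)) : IsUpperGradient g u := by
  refine ⟨hg, fun L γ hL hγ => ?_⟩
  obtain ⟨η, hη, he⟩ := hγ.exists_lipschitzWith hL.le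
  rw [← he (left_mem_Icc.2 hL.le), ← he (right_mem_Icc.2 hL.le)]
  refine (h η hη L hL.le).trans_eq (setLIntegral_congr_fun measurableSet_Icc fun t ht => ?_)
  simp only [he ht]

/-! ### The path infimum -/

/-- The infimum of `∫_0^T g(γ(t)) dt` over all `1`-Lipschitz curves `γ` with `γ(0) = y` and
`γ(T) ∈ F`. Curves parametrized by arc length are among these; unlike them, `1`-Lipschitz curves
are stable under pointwise limits. Only the values of `γ` on `[0, T]` matter, but `γ` is defined on
the whole line. -/
noncomputable def pathInf (g : Y → ℝ≥0∞) (F : Set Y) (y : Y) : ℝ≥0∞ :=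
  ⨅ (T : ℝ) (γ : ℝ → Y) (_ : 0 ≤ T ∧ LipschitzWith 1 γ ∧ γ 0 = y ∧ γ T ∈ F),
    ∫⁻ t in Icc 0 T, g (γ t)

omit [MeasurableSpace Y] in
theorem pathInf_le {g : Y → ℝ≥0∞} {F : Set Y} {y : Y} {T : ℝ} {γ : ℝ → Y} (hT : 0 ≤ T)
    (hγ : LipschitzWith 1 γ) (h0 : γ 0 = y) (h1 : γ T ∈ F) :
    pathInf g F y ≤ ∫⁻ t in Icc 0 T, g (γ t) :=
  iInf_le_of_le T (iInf_le_of_le γ (iInf_le _ ⟨hT, hγ, h0, h1⟩))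

omit [MeasurableSpace Y] in
theorem pathInf_eq_zero {g : Y → ℝ≥0∞} {F : Set Y} {y : Y} (hy : y ∈ F) : pathInf g F y = 0 := by
  refine le_antisymm ((pathInf_le (T := 0) (γ := fun _ => y) le_rfl
    (LipschitzWith.const' y) rfl hy).trans ?_) (by positivity)
  simp

theorem setLIntegral_Icc_comp_add_left (f : ℝ → ℝ≥0∞) (a b c : ℝ) :
    ∫⁻ t in Icc a b, f (c + t) = ∫⁻ t in Icc (c + a) (c + b), f t := by
  have := (measurePreserving_add_left (volume : Measure ℝ) c).setLIntegral_comp_preimage_emb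
    (measurableEmbedding_addLeft c) f (Icc (c + a) (c + b))
  rw [← this]
  congr 2
  ext t; simp

theorem setLIntegral_Icc_comp_sub_left (f : ℝ → ℝ≥0∞) (a b c : ℝ) :
    ∫⁻ t in Icc a b, f (c - t) = ∫⁻ t in Icc (c - b) (c - a), f t := by
  have := (Measure.measurePreserving_sub_left (volume : Measure ℝ) c).setLIntegral_comp_preimage_emb
    (MeasurableEquiv.subLeft c).measurableEmbedding f (Icc (c - b) (c - a))
  rw [← this]
  congr 2
  ext t; simp

theorem setLIntegral_Icc_add_Icc (f : ℝ → ℝ≥0∞) {a b c : ℝ} (hab : a ≤ b) (hbc : b ≤ c) :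
    (∫⁻ t in Icc a b, f t) + ∫⁻ t in Icc b c, f t = ∫⁻ t in Icc a c, f t := by
  rw [← Icc_union_Ioc_eq_Icc hab hbc, lintegral_union measurableSet_Ioc
    (disjoint_left.2 fun t ht ht' => ht'.1.not_ge ht.2), setLIntegral_congr Ioc_ae_eq_Icc]

theorem _root_.LipschitzWith.one_comp {X Z W : Type*} [PseudoEMetricSpace X]
    [PseudoEMetricSpace Z] [PseudoEMetricSpace W] {f : Z → W} {g : X → Z}
    (hf : LipschitzWith 1 f) (hg : LipschitzWith 1 g) : LipschitzWith 1 (fun t => f (g t)) := by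
  have := hf.comp hg
  rwa [one_mul] at this

theorem _root_.LipschitzWith.piecewise_Iic {X : Type*} [PseudoEMetricSpace X] {γ η : ℝ → X}
    (hγ : LipschitzWith 1 γ) (hη : LipschitzWith 1 η) {a : ℝ} (h : γ a = η a) :
    LipschitzWith 1 (fun t => if t ≤ a then γ t else η t) := by
  have key : ∀ s t, s ≤ t → edist (if s ≤ a then γ s else η s) (if t ≤ a then γ t else η t) ≤
      edist s t := by
    intro s t hst
    split_ifs with h1 h2 h2
    · simpa using hγ s t
    · calc edist (γ s) (η t) ≤ edist (γ s) (γ a) + edist (η a) (η t) := h ▸ edist_triangle _ _ _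
        _ ≤ edist s a + edist a t := by
            simpa using add_le_add (hγ s a) (hη a t)
        _ = edist s t := by
            rw [not_le] at h2
            rw [edist_dist, edist_dist, edist_dist, ← ENNReal.ofReal_add dist_nonneg dist_nonneg,
              Real.dist_eq, Real.dist_eq, Real.dist_eq, abs_of_nonpos (by linarith),
              abs_of_nonpos (by linarith), abs_of_nonpos (by linarith)]
            congr 1; ring
    · exact absurd (hst.trans h2) h1
    · simpa using hη s t
  intro s t
  rw [ENNReal.coe_one, one_mul]
  rcases le_total s t with hst | hst
  · exact key s t hst
  · rw [edist_comm, edist_comm s t]; exact key t s hst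

omit [MeasurableSpace Y] in
theorem pathInf_le_add {g : Y → ℝ≥0∞} {F : Set Y} {γ : ℝ → Y} (hγ : LipschitzWith 1 γ) {T : ℝ}
    (hT : 0 ≤ T) :
    pathInf g F (γ 0) ≤ (∫⁻ t in Icc 0 T, g (γ t)) + pathInf g F (γ T) := by
  conv_rhs => rw [pathInf]
  simp only [ENNReal.add_iInf]
  refine le_iInf fun S => le_iInf fun η => le_iInf fun ⟨hS, hη, h0, h1⟩ => ?_
  have hη' : LipschitzWith 1 (fun t => η (-T + t)) :=
    hη.one_comp (LipschitzWith.of_dist_le_mul (by simp))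
  set ζ : ℝ → Y := fun t => if t ≤ T then γ t else η (-T + t) with hζ
  have hζl : LipschitzWith 1 ζ := hγ.piecewise_Iic hη' (by simp [h0])
  have hζT : ∀ t, T ≤ t → ζ t = η (-T + t) := by
    intro t ht
    rcases ht.eq_or_lt with rfl | ht
    · simp [hζ, h0]
    · simp [hζ, ht]
  refine (pathInf_le (T := T + S) (γ := ζ) (by positivity) hζl (by simp [hζ, hT]) ?_).trans_eq ?_
  · rw [hζT _ (by linarith)]; simpa using h1
  · rw [← setLIntegral_Icc_add_Icc _ hT (by linarith)]
    congr 1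
    · exact setLIntegral_congr_fun measurableSet_Icc fun t ht => by simp [hζ, ht.2]
    · rw [setLIntegral_congr_fun (g := fun t => g (η (-T + t))) measurableSet_Icc
        fun t ht => by simp only [hζT t ht.1], setLIntegral_Icc_comp_add_left (fun t => g (η t))]
      congr 3 <;> ring

omit [MeasurableSpace Y] in
theorem pathInf_le_add' {g : Y → ℝ≥0∞} {F : Set Y} {γ : ℝ → Y} (hγ : LipschitzWith 1 γ) {T : ℝ}
    (hT : 0 ≤ T) :
    pathInf g F (γ T) ≤ (∫⁻ t in Icc 0 T, g (γ t)) + pathInf g F (γ 0) := by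
  have h : LipschitzWith 1 (fun t => γ (T - t)) := by
    refine hγ.one_comp (LipschitzWith.of_dist_le_mul fun s t => le_of_eq ?_)
    rw [NNReal.coe_one, one_mul, Real.dist_eq, Real.dist_eq, abs_sub_comm s t]
    congr 1; ring
  have := pathInf_le_add (g := g) (F := F) h hT
  rw [setLIntegral_Icc_comp_sub_left (fun t => g (γ t))] at this
  simpa using this

/-- If `g` is an upper gradient of a function that vanishes on `F` and is at least `1` at `y`,
then every curve from `y` to `F` has `g`-length at least `1`. -/
theorem one_le_pathInf {g : Y → ℝ≥0∞} {u : Y → ℝ} (h : IsUpperGradient g u) {F : Set Y}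
    (hF : ∀ z ∈ F, u z = 0) {y : Y} (hy : 1 ≤ u y) : 1 ≤ pathInf g F y := by
  refine le_iInf fun T => le_iInf fun γ => le_iInf fun ⟨hT, hγ, h0, h1⟩ => ?_
  refine le_trans ?_ (h.ofReal_abs_sub_le hγ hT)
  rw [h0, hF _ h1, sub_zero, ← ENNReal.ofReal_one]
  exact ENNReal.ofReal_le_ofReal (hy.trans (le_abs_self _))

/-- The path infimum of a lower semicontinuous function that is bounded away from `0` is lower
semicontinuous: nearly optimal curves have bounded length, so they subconverge by Arzelà-Ascoli,
and Fatou's lemma applies to the integrals. -/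
theorem lowerSemicontinuous_pathInf [CompactSpace Y] [BorelSpace Y] {g : Y → ℝ≥0∞} {F : Set Y}
    (hF : IsClosed F) (hg : LowerSemicontinuous g) {ε : ℝ≥0∞} (hε : ε ≠ 0) (hεt : ε ≠ ∞)
    (hgε : ∀ y, ε ≤ g y) : LowerSemicontinuous (pathInf g F) := by
  rw [lowerSemicontinuous_iff_isClosed_preimage]
  intro c
  rcases eq_or_ne c ∞ with rfl | hc
  · simp
  refine IsSeqClosed.isClosed fun y y₀ hy hlim => ?_
  have hlt : ∀ n : ℕ, pathInf g F (y n) < c + ((n : ℝ≥0∞) + 1)⁻¹ := fun n =>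
    (hy n).trans_lt (ENNReal.lt_add_right hc (by simp))
  simp only [pathInf, iInf_lt_iff] at hlt
  choose T γ hγ hcost using hlt
  -- a curve of cost at most `c + 1` has a parameter interval of length at most `(c + 1) / ε`
  set M : ℝ := ((c + 1) / ε).toReal with hM
  have hTM : ∀ n, T n ∈ Icc 0 M := by
    intro n
    refine ⟨(hγ n).1, ?_⟩
    have h1 : ε * ENNReal.ofReal (T n) ≤ c + 1 := by
      calc ε * ENNReal.ofReal (T n) = ∫⁻ _ in Icc 0 (T n), ε := by simp
        _ ≤ ∫⁻ t in Icc 0 (T n), g (γ n t) := lintegral_mono fun t => hgε _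
        _ ≤ c + ((n : ℝ≥0∞) + 1)⁻¹ := (hcost n).le
        _ ≤ c + 1 := by gcongr; simp
    have h2 : ENNReal.ofReal (T n) ≤ (c + 1) / ε :=
      (ENNReal.le_div_iff_mul_le (Or.inl hε) (Or.inl hεt)).2 (by rwa [mul_comm])
    exact (ENNReal.ofReal_le_iff_le_toReal (by finiteness)).1 h2
  have hM0 : 0 ≤ M := ENNReal.toReal_nonneg
  let f : ℕ → BoundedContinuousFunction (Icc 0 M) Y := fun n =>
    BoundedContinuousFunction.mkOfCompact ⟨fun t => γ n t, by
      exact (hγ n).2.1.continuous.comp continuous_subtype_val⟩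
  have hcpt : IsCompact {q : BoundedContinuousFunction (Icc 0 M) Y | LipschitzWith 1 q} := by
    refine BoundedContinuousFunction.arzela_ascoli₁ _ ?_ ?_
    · have : {q : BoundedContinuousFunction (Icc 0 M) Y | LipschitzWith 1 q} =
          ⋂ (s : Icc 0 M) (t : Icc 0 M), {q | dist (q s) (q t) ≤ dist s t} := by
        ext q
        simp only [lipschitzWith_iff_dist_le_mul, NNReal.coe_one, one_mul, mem_iInter,
          mem_ofPred_eq]
      rw [this]
      refine isClosed_iInter fun s => isClosed_iInter fun t => isClosed_le ?_ continuous_const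
      exact (continuous_eval_const s).dist
        (continuous_eval_const t)
    · exact (LipschitzWith.uniformEquicontinuous _ 1 fun q => q.2).equicontinuous
  have hmem : ∀ n, (f n, T n) ∈
      {q : BoundedContinuousFunction (Icc 0 M) Y | LipschitzWith 1 q} ×ˢ Icc 0 M := fun n =>
    ⟨fun s t => (hγ n).2.1 s t, hTM n⟩
  obtain ⟨⟨q, S⟩, ⟨hq, hS⟩, φ, hφ, hconv⟩ := (hcpt.prod isCompact_Icc).tendsto_subseq hmem
  have hconvT : Tendsto (fun n => T (φ n)) atTop (𝓝 S) := hconv.snd_nhds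
  have hconvf : ∀ t : Icc 0 M, Tendsto (fun n => γ (φ n) t) atTop (𝓝 (q t)) := fun t =>
    ((continuous_eval_const t).tendsto q).comp hconv.fst_nhds
  set η : ℝ → Y := fun t => q (projIcc 0 M hM0 t) with hη
  have hηl : LipschitzWith 1 η :=
    LipschitzWith.one_comp (show LipschitzWith 1 q from hq) (LipschitzWith.projIcc hM0)
  have hηlim : ∀ t ∈ Icc 0 M, Tendsto (fun n => γ (φ n) t) atTop (𝓝 (η t)) := fun t ht => by
    simpa [hη, projIcc_of_mem hM0 ht] using hconvf ⟨t, ht⟩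
  have hη0 : η 0 = y₀ := by
    refine tendsto_nhds_unique (hηlim 0 (left_mem_Icc.2 hM0)) ?_
    have : (fun n => γ (φ n) 0) = fun n => y (φ n) := funext fun n => (hγ (φ n)).2.2.1
    rw [this]
    exact hlim.comp hφ.tendsto_atTop
  have hηF : η S ∈ F := by
    have : Tendsto (fun n => γ (φ n) (T (φ n))) atTop (𝓝 (η S)) := by
      refine (tendsto_iff_of_dist ?_).1 (hηlim S hS)
      refine squeeze_zero (fun n => dist_nonneg) (fun n => (hγ (φ n)).2.1.dist_le_mul _ _) ?_
      have := hconvT.const_sub S |>.norm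
      simpa [Real.dist_eq] using this
    exact hF.mem_of_tendsto this (Eventually.of_forall fun n => (hγ (φ n)).2.2.2)
  change pathInf g F y₀ ≤ c
  refine (pathInf_le hS.1 hηl hη0 hηF).trans ?_
  calc ∫⁻ t in Icc 0 S, g (η t) = ∫⁻ t, (Ico 0 S).indicator (fun t => g (η t)) t := by
        rw [lintegral_indicator measurableSet_Ico, setLIntegral_congr Ico_ae_eq_Icc]
    _ ≤ ∫⁻ t, liminf (fun n => (Icc 0 (T (φ n))).indicator (fun t => g (γ (φ n) t)) t) atTop := by
        refine lintegral_mono fun t => ?_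
        by_cases ht : t ∈ Ico 0 S
        · rw [indicator_of_mem ht]
          refine le_of_forall_lt_imp_le_of_dense fun a ha =>
            le_liminf_of_le (by isBoundedDefault) ?_
          filter_upwards [(hηlim t ⟨ht.1, ht.2.le.trans hS.2⟩).eventually (hg _ a ha),
            hconvT.eventually (lt_mem_nhds ht.2)] with n hn hn'
          rw [indicator_of_mem (show t ∈ Icc 0 (T (φ n)) from ⟨ht.1, hn'.le⟩)]
          exact hn.le
        · rw [indicator_of_notMem ht]; exact zero_le
    _ ≤ liminf (fun n => ∫⁻ t, (Icc 0 (T (φ n))).indicator (fun t => g (γ (φ n) t)) t) atTop :=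
        lintegral_liminf_le fun n =>
          (hg.measurable.comp (hγ (φ n)).2.1.continuous.measurable).indicator measurableSet_Icc
    _ ≤ liminf (fun n => c + (((φ n : ℕ) : ℝ≥0∞) + 1)⁻¹) atTop := by
        refine liminf_le_liminf (Eventually.of_forall fun n => ?_)
        rw [lintegral_indicator measurableSet_Icc]
        exact (hcost (φ n)).le
    _ = c := by
        refine Tendsto.liminf_eq ?_
        have h1 : Tendsto (fun n : ℕ => (((n : ℕ) : ℝ≥0∞) + 1)⁻¹) atTop (𝓝 0) := by
          have := ENNReal.tendsto_inv_nat_nhds_zero.comp (tendsto_add_atTop_nat 1)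
          simpa [Function.comp_def] using this
        simpa using (h1.comp hφ.tendsto_atTop).const_add c

/-! ### Upper gradients of cutoff functions and of convex combinations -/

theorem IsUpperGradient.mono {g g' : Y → ℝ≥0∞} {u : Y → ℝ} (h : IsUpperGradient g u)
    (hg' : Measurable g') (hle : ∀ y, g y ≤ g' y) : IsUpperGradient g' u :=
  ⟨hg', fun L γ hL hγ => (h.2 L γ hL hγ).trans (lintegral_mono fun _ => hle _)⟩

theorem IsUpperGradient.ofReal_abs_sub_le_Icc {g : Y → ℝ≥0∞} {u : Y → ℝ}
    (h : IsUpperGradient g u) {γ : ℝ → Y} (hγ : LipschitzWith 1 γ) {s t : ℝ} (hst : s ≤ t) :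
    ENNReal.ofReal |u (γ s) - u (γ t)| ≤ ∫⁻ τ in Icc s t, g (γ τ) := by
  have h' : LipschitzWith 1 (fun τ => γ (s + τ)) :=
    hγ.one_comp (LipschitzWith.of_dist_le_mul (by simp))
  have := h.ofReal_abs_sub_le h' (sub_nonneg.2 hst)
  rw [setLIntegral_Icc_comp_add_left (fun τ => g (γ τ))] at this
  simpa using this

/-- A nonnegative `k`-Lipschitz function has the upper gradient `k` on any open set outside which
it vanishes: along a curve, the nonzero values between the end values are taken inside that set, and
Lipschitz maps increase Lebesgue measure at most by the factor `k`. -/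
theorem isUpperGradient_indicator [BorelSpace Y] {φ : Y → ℝ} {k : NNReal} {U : Set Y}
    (hU : IsOpen U) (hφ : LipschitzWith k φ) (h0 : ∀ y, 0 ≤ φ y) (hφU : ∀ y ∉ U, φ y = 0) :
    IsUpperGradient (U.indicator fun _ => (k : ℝ≥0∞)) φ := by
  refine isUpperGradient_of_lipschitzWith (measurable_const.indicator hU.measurableSet)
    fun γ hγ T hT => ?_
  have hψ : LipschitzWith k (fun t => φ (γ t)) := by
    simpa [Function.comp_def] using hφ.comp hγ
  have hUγ : MeasurableSet (γ ⁻¹' U) := (hU.preimage hγ.continuous).measurableSet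
  have hsub : uIoo (φ (γ 0)) (φ (γ T)) ⊆ (fun t => φ (γ t)) '' (γ ⁻¹' U ∩ Icc 0 T) := by
    intro c hc
    obtain ⟨t, ht, rfl⟩ := intermediate_value_uIcc (f := fun t => φ (γ t))
      hψ.continuous.continuousOn (a := 0) (b := T) (uIoo_subset_uIcc_self hc)
    rw [uIcc_of_le hT] at ht
    refine ⟨t, ⟨?_, ht⟩, rfl⟩
    by_contra hn
    have h1 : φ (γ t) = 0 := hφU _ hn
    have h2 : min (φ (γ 0)) (φ (γ T)) < φ (γ t) := hc.1
    rw [h1] at h2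
    exact h2.not_ge (le_min (h0 _) (h0 _))
  have himg := (hψ.lipschitzOnWith (s := γ ⁻¹' U ∩ Icc 0 T)).hausdorffMeasure_image_le
    (zero_le_one (α := ℝ))
  rw [hausdorffMeasure_real, ENNReal.rpow_one] at himg
  calc ENNReal.ofReal |φ (γ 0) - φ (γ T)| = volume (uIoo (φ (γ 0)) (φ (γ T))) := by
        rw [uIoo, Real.volume_Ioo, max_sub_min_eq_abs, abs_sub_comm]
    _ ≤ k * volume (γ ⁻¹' U ∩ Icc 0 T) := (measure_mono hsub).trans himg
    _ = ∫⁻ t in Icc 0 T, (γ ⁻¹' U).indicator (fun _ => (k : ℝ≥0∞)) t := by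
        rw [lintegral_indicator hUγ, Measure.restrict_restrict hUγ, setLIntegral_const]
    _ = _ := rfl

/-- An increment bound that holds on all short intervals holds on every interval. -/
theorem ofReal_abs_sub_le_of_local {f : ℝ → ℝ} {F : ℝ → ℝ≥0∞} {T δ : ℝ} (hT : 0 ≤ T) (hδ : 0 < δ)
    (h : ∀ s t, 0 ≤ s → s ≤ t → t ≤ T → t - s ≤ δ →
      ENNReal.ofReal |f s - f t| ≤ ∫⁻ τ in Icc s t, F τ) :
    ENNReal.ofReal |f 0 - f T| ≤ ∫⁻ τ in Icc 0 T, F τ := by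
  have key : ∀ (n : ℕ) (t : ℝ), 0 ≤ t → t ≤ T → t ≤ n * δ →
      ENNReal.ofReal |f 0 - f t| ≤ ∫⁻ τ in Icc 0 t, F τ := by
    intro n
    induction n with
    | zero =>
      intro t h0 hT' ht
      have : t = 0 := le_antisymm (by simpa using ht) h0
      simp [this]
    | succ n ih =>
      intro t h0 hT' ht
      push_cast at ht
      have hs0 : 0 ≤ max 0 (t - δ) := le_max_left _ _
      have hst : max 0 (t - δ) ≤ t := max_le h0 (by linarith)
      rw [← setLIntegral_Icc_add_Icc F hs0 hst]
      refine le_trans ?_ (add_le_add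
        (ih _ hs0 (hst.trans hT') (max_le (by positivity) (by linarith)))
        (h _ t hs0 hst hT' (by linarith [le_max_right 0 (t - δ)])))
      rw [← ENNReal.ofReal_add (abs_nonneg _) (abs_nonneg _)]
      exact ENNReal.ofReal_le_ofReal (abs_sub_le _ _ _)
  obtain ⟨n, hn⟩ := exists_nat_ge (T / δ)
  exact key n T hT le_rfl ((div_le_iff₀ hδ).1 hn)

/-- The product rule for `v + φ (1 - v) = 1 - (1 - φ) (1 - v)`. Along a curve on which `g` has
finite integral `v` is continuous, so that the factor `1 - v` is almost constant on short pieces of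
the curve. -/
theorem IsUpperGradient.add_mul_one_sub [BorelSpace Y] {v φ : Y → ℝ} {g h : Y → ℝ≥0∞}
    (hv : IsUpperGradient g v) (hφ : IsUpperGradient h φ) (hvm : Measurable v)
    (hφ0 : ∀ y, 0 ≤ φ y) (hφ1 : ∀ y, φ y ≤ 1) {k : NNReal} (hk : ∀ y, h y ≤ k) :
    IsUpperGradient (fun y => g y + ‖1 - v y‖ₑ * h y) (fun y => v y + φ y * (1 - v y)) := by
  have hgm := hv.1
  have hhm := hφ.1
  refine isUpperGradient_of_lipschitzWith (by fun_prop) fun γ hγ T hT => ?_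
  have hγm := hγ.continuous.measurable
  have hgγ : Measurable (fun t => g (γ t)) := hgm.comp hγm
  have hhγ : Measurable (fun t => h (γ t)) := hhm.comp hγm
  rcases eq_or_ne (∫⁻ t in Icc 0 T, g (γ t)) ∞ with hinf | hfin
  · refine le_top.trans (hinf.symm.le.trans (lintegral_mono fun t => le_self_add))
  refine ENNReal.le_of_forall_pos_le_add fun ε₀ hε₀ _ => ?_
  have hH : ∫⁻ t in Icc 0 T, h (γ t) ≠ ∞ := by
    refine ne_top_of_le_ne_top ?_ (lintegral_mono (g := fun _ => (k : ℝ≥0∞)) fun t => hk _)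
    simpa using ENNReal.mul_ne_top ENNReal.coe_ne_top ENNReal.ofReal_ne_top
  obtain ⟨ε, hε, hεH⟩ := ENNReal.exists_nnreal_pos_mul_lt hH
    (ENNReal.coe_ne_zero.2 (ne_of_gt hε₀))
  obtain ⟨δ, hδ, hsmall⟩ := exists_pos_setLIntegral_lt_of_measure_lt hfin
    (ENNReal.coe_ne_zero.2 (ne_of_gt hε))
  obtain ⟨δ', hδ', hδδ'⟩ : ∃ δ' : ℝ, 0 < δ' ∧ ENNReal.ofReal δ' < δ := by
    obtain ⟨d, hd0, hd⟩ := ENNReal.lt_iff_exists_nnreal_btwn.1 hδ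
    exact ⟨d, by exact_mod_cast hd0, by simpa using hd⟩
  have hcont : ∀ s t, 0 ≤ s → s ≤ t → t ≤ T → t - s ≤ δ' →
      ENNReal.ofReal |v (γ s) - v (γ t)| ≤ ε := by
    intro s t hs hst ht hd
    have hm := hsmall (Icc s t) (by
      refine (Measure.restrict_apply_le _ _).trans_lt (lt_of_le_of_lt ?_ hδδ')
      rw [Real.volume_Icc]
      exact ENNReal.ofReal_le_ofReal hd)
    rw [Measure.restrict_restrict measurableSet_Icc,
      inter_eq_self_of_subset_left (Icc_subset_Icc hs ht)] at hm
    exact (hv.ofReal_abs_sub_le_Icc hγ hst).trans hm.le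
  set F : ℝ → ℝ≥0∞ := fun t => (g (γ t) + ‖1 - v (γ t)‖ₑ * h (γ t)) + ε * h (γ t) with hF
  have hloc := ofReal_abs_sub_le_of_local (f := fun t => v (γ t) + φ (γ t) * (1 - v (γ t)))
    (F := F) hT hδ' (by
      intro s t hs hst ht hd
      have e : (v (γ s) + φ (γ s) * (1 - v (γ s))) - (v (γ t) + φ (γ t) * (1 - v (γ t))) =
          (1 - φ (γ t)) * (v (γ s) - v (γ t)) + (1 - v (γ s)) * (φ (γ s) - φ (γ t)) := by ring
      have h1 : ‖(1 - φ (γ t)) * (v (γ s) - v (γ t))‖ₑ ≤ ∫⁻ τ in Icc s t, g (γ τ) := by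
        refine le_trans ?_ (hv.ofReal_abs_sub_le_Icc hγ hst)
        rw [Real.enorm_eq_ofReal_abs, abs_mul]
        refine ENNReal.ofReal_le_ofReal (mul_le_of_le_one_left (abs_nonneg _) ?_)
        rw [abs_le]
        constructor <;> linarith [hφ0 (γ t), hφ1 (γ t)]
      have h2 : ‖(1 - v (γ s)) * (φ (γ s) - φ (γ t))‖ₑ ≤
          ∫⁻ τ in Icc s t, (‖1 - v (γ τ)‖ₑ * h (γ τ) + ε * h (γ τ)) := by
        rw [enorm_mul]
        calc _ ≤ ‖1 - v (γ s)‖ₑ * ∫⁻ τ in Icc s t, h (γ τ) := by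
              gcongr
              rw [Real.enorm_eq_ofReal_abs]
              exact hφ.ofReal_abs_sub_le_Icc hγ hst
          _ = ∫⁻ τ in Icc s t, ‖1 - v (γ s)‖ₑ * h (γ τ) :=
              (lintegral_const_mul _ hhγ).symm
          _ ≤ _ := by
              refine setLIntegral_mono' measurableSet_Icc fun τ hτ => ?_
              rw [← add_mul]
              gcongr
              have e' : 1 - v (γ s) = (1 - v (γ τ)) - (v (γ s) - v (γ τ)) := by ring
              rw [e']
              refine enorm_sub_le.trans ?_
              gcongr
              rw [Real.enorm_eq_ofReal_abs]
              exact hcont s τ hs hτ.1 (hτ.2.trans ht) (by linarith [hτ.2])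
      rw [← Real.enorm_eq_ofReal_abs, e]
      refine (enorm_add_le _ _).trans ((add_le_add h1 h2).trans_eq ?_)
      rw [← lintegral_add_left hgγ]
      simp only [hF, add_assoc])
  refine hloc.trans ?_
  rw [hF, lintegral_add_right _ (hhγ.const_mul _), lintegral_const_mul _ hhγ]
  gcongr

/-- The standard cutoff function of the ball `B(x, r)`, supported in `B(x, 2r)`. -/
noncomputable def cutoff (x : Y) (r : ℝ) (y : Y) : ℝ := max 0 (min 1 (2 - r⁻¹ * dist y x))

section Cutoff

omit [MeasurableSpace Y]

theorem cutoff_nonneg (x : Y) (r : ℝ) (y : Y) : 0 ≤ cutoff x r y := le_max_left _ _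

theorem cutoff_le_one (x : Y) (r : ℝ) (y : Y) : cutoff x r y ≤ 1 :=
  max_le zero_le_one (min_le_left _ _)

theorem cutoff_eq_one {x y : Y} {r : ℝ} (hr : 0 < r) (hy : y ∈ closedBall x r) :
    cutoff x r y = 1 := by
  have : r⁻¹ * dist y x ≤ 1 := by
    rw [inv_mul_le_iff₀ hr, mul_one]; exact hy
  rw [cutoff, min_eq_left (by linarith), max_eq_right zero_le_one]

theorem cutoff_eq_zero {x y : Y} {r : ℝ} (hr : 0 < r) (hy : y ∉ ball x (2 * r)) :
    cutoff x r y = 0 := by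
  have : 2 ≤ r⁻¹ * dist y x := by
    rw [le_inv_mul_iff₀ hr, mul_comm]; simpa using hy
  rw [cutoff]
  exact max_eq_left ((min_le_right _ _).trans (by linarith))

theorem lipschitzWith_cutoff (x : Y) {r : ℝ} (hr : 0 < r) :
    LipschitzWith (r⁻¹).toNNReal (cutoff x r) := by
  have h : LipschitzWith (r⁻¹).toNNReal (fun y => 2 - r⁻¹ * dist y x) := by
    refine LipschitzWith.of_le_add_mul _ fun y z => ?_
    rw [Real.coe_toNNReal _ (by positivity)]
    have := mul_le_mul_of_nonneg_left (dist_triangle_left z x y) (inv_nonneg.2 hr.le)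
    linarith
  exact (h.const_min 1).const_max 0

end Cutoff

theorem isUpperGradient_cutoff [BorelSpace Y] (x : Y) {r : ℝ} (hr : 0 < r) :
    IsUpperGradient ((ball x (2 * r)).indicator fun _ => ((r⁻¹).toNNReal : ℝ≥0∞)) (cutoff x r) :=
  isUpperGradient_indicator isOpen_ball (lipschitzWith_cutoff x hr) (cutoff_nonneg x r)
    fun _ hy => cutoff_eq_zero hr hy

/-! ### Comparison of the capacities -/

theorem memLp_of_mem_Icc [OpensMeasurableSpace Y] {μ : Measure Y} [IsFiniteMeasure μ] {v : Y → ℝ}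
    (hv : Measurable v) (h0 : ∀ y, 0 ≤ v y) (h1 : ∀ y, v y ≤ 1) (q : ℝ≥0∞) : MemLp v q μ :=
  MemLp.of_bound hv.aestronglyMeasurable 1 (Eventually.of_forall fun y => by
    rw [Real.norm_eq_abs, abs_of_nonneg (h0 y)]; exact h1 y)

/-- A nonnegative function has lower semicontinuous majorants, bounded away from `0`, with almost
the same `p`-th power integral. -/
theorem exists_lowerSemicontinuous_rpow_le [BorelSpace Y] {p : ℝ} (hp : 0 < p) {μ : Measure Y}
    [IsFiniteMeasure μ] {g : Y → ℝ≥0∞} (hg : Measurable g) {ε : ℝ≥0∞} (hε : ε ≠ 0) :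
    ∃ (g' : Y → ℝ≥0∞) (a : ℝ≥0∞), LowerSemicontinuous g' ∧ (∀ y, g y ≤ g' y) ∧ a ≠ 0 ∧ a ≠ ∞ ∧
      (∀ y, a ≤ g' y) ∧ ∫⁻ y, g' y ^ p ∂μ ≤ (∫⁻ y, g y ^ p ∂μ) + ε := by
  have hε2 : ε / 2 ≠ 0 := by simpa using hε
  obtain ⟨G, hgG, hG, hint⟩ := exists_le_lowerSemicontinuous_lintegral_ge μ (fun y => g y ^ p)
    (hg.pow_const p) hε2
  obtain ⟨b, hb, hbμ⟩ := ENNReal.exists_nnreal_pos_mul_lt (measure_ne_top μ univ) hε2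
  have hp' : 0 ≤ 1 / p := by positivity
  refine ⟨fun y => (G y + b) ^ (1 / p), (b : ℝ≥0∞) ^ (1 / p), ?_, fun y => ?_, ?_, ?_, fun y => ?_,
    ?_⟩
  · have hc : Continuous (fun z : ℝ≥0∞ => (z + b) ^ (1 / p)) :=
      ENNReal.continuous_rpow_const.comp (continuous_id.add continuous_const)
    exact hc.comp_lowerSemicontinuous hG fun c d hcd => by dsimp only; gcongr
  · calc g y = (g y ^ p) ^ (1 / p) := by
          rw [← ENNReal.rpow_mul, mul_one_div_cancel hp.ne', ENNReal.rpow_one]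
      _ ≤ _ := ENNReal.rpow_le_rpow ((hgG y).trans le_self_add) hp'
  · simp [ENNReal.rpow_eq_zero_iff, hb.ne', hp]
  · exact ENNReal.rpow_ne_top_of_nonneg hp' ENNReal.coe_ne_top
  · exact ENNReal.rpow_le_rpow le_add_self hp'
  · calc ∫⁻ y, ((G y + b) ^ (1 / p)) ^ p ∂μ = ∫⁻ y, (G y + b) ∂μ := by
          refine lintegral_congr fun y => ?_
          rw [← ENNReal.rpow_mul, one_div_mul_cancel hp.ne', ENNReal.rpow_one]
      _ = (∫⁻ y, G y ∂μ) + b * μ univ := by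
          rw [lintegral_add_right _ measurable_const, lintegral_const]
      _ ≤ ((∫⁻ y, g y ^ p ∂μ) + ε / 2) + ε / 2 := add_le_add hint hbμ.le
      _ = _ := by rw [add_assoc, ENNReal.add_halves]

theorem _root_.ENNReal.ofReal_abs_toReal_sub_le {a b c : ℝ≥0∞} (ha : a ≠ ∞) (hb : b ≠ ∞)
    (hab : a ≤ c + b) (hba : b ≤ c + a) : ENNReal.ofReal |a.toReal - b.toReal| ≤ c := by
  rcases eq_or_ne c ∞ with rfl | hc
  · exact le_top
  rw [ENNReal.ofReal_le_iff_le_toReal hc, abs_sub_le_iff]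
  have h1 := ENNReal.toReal_mono (by finiteness) hab
  have h2 := ENNReal.toReal_mono (by finiteness) hba
  rw [ENNReal.toReal_add hc hb] at h1
  rw [ENNReal.toReal_add hc ha] at h2
  constructor <;> linarith

theorem isUpperGradient_pathInf [BorelSpace Y] {g : Y → ℝ≥0∞} (hg : Measurable g) (F : Set Y) :
    IsUpperGradient g (fun y => (min (pathInf g F y) 1).toReal) := by
  have hmin : ∀ a b c : ℝ≥0∞, a ≤ c + b → min a 1 ≤ c + min b 1 := fun a b c h => by
    rw [← min_add_add_left]
    exact min_le_min h le_add_self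
  refine isUpperGradient_of_lipschitzWith hg fun γ hγ T hT => ?_
  exact ENNReal.ofReal_abs_toReal_sub_le (by simp) (by simp)
    (hmin _ _ _ (pathInf_le_add hγ hT)) (hmin _ _ _ (pathInf_le_add' hγ hT))

/-- The capacity of a ball is bounded by the capacity of its part in the codimension `Θ` set. A
competitor `u` for the latter, with upper gradient `g`, is replaced by the truncated path infimum
`v` of a lower semicontinuous majorant of `g`; then `v + φ (1 - v)`, with `φ` a cutoff function, is
a competitor for the former whose energy is controlled by the Maz'ya type inequality. -/
theorem exists_relCapacity_closedBall_le [CompactSpace Y] [BorelSpace Y] {p Θ : ℝ} (hp : 1 < p)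
    (hΘ : 0 < Θ) (hΘp : Θ < p) {μ : Measure Y} (hμ : IsDoubling μ) (hP : SupportsPoincare p μ)
    {E : Set Y} (hE : IsClosed E) {ν : Measure Y} (hν : IsCodimensional Θ μ ν E) :
    ∃ C : ℝ≥0∞, C ≠ 0 ∧ C ≠ ∞ ∧ ∀ x ∈ E, ∀ r : ℝ, 0 < r → r < diam E / 4 →
      relCapacity p μ (closedBall x r) (ball x (2 * r))ᶜ ≤
        C * relCapacity p μ (closedBall x r ∩ E) (ball x (2 * r))ᶜ := by
  have hp0 : 0 < p := by linarith
  have := hμ.isFiniteMeasure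
  obtain ⟨A, l, hA, hl, hP⟩ := hP
  obtain ⟨C₁, hC₁, hmaz⟩ := exists_setLIntegral_one_sub_rpow_le hp hΘ hΘp hA hl hμ hE hν
  have h2p : (2 : ℝ≥0∞) ^ (p - 1) ≠ ∞ := ENNReal.rpow_ne_top_of_nonneg (by linarith) (by simp)
  have h2p0 : (2 : ℝ≥0∞) ^ (p - 1) ≠ 0 := (ENNReal.rpow_pos (by simp) (by simp)).ne'
  set C := (2 : ℝ≥0∞) ^ (p - 1) * (1 + C₁) with hC
  have hC0 : C ≠ 0 := mul_ne_zero h2p0 (by simp)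
  have hCt : C ≠ ∞ := by finiteness
  refine ⟨C, hC0, hCt, fun x hx r hr hrE => ?_⟩
  set F := (ball x (2 * r))ᶜ with hF
  have hFc : IsClosed F := isOpen_ball.isClosed_compl
  conv_rhs => rw [relCapacity]
  simp only [energy, ENNReal.mul_iInf_of_ne hC0 hCt]
  refine le_iInf fun u => le_iInf fun _ => le_iInf fun huK => le_iInf fun huF =>
    le_iInf fun g => le_iInf fun hg => ?_
  rcases eq_or_ne (∫⁻ y, g y ^ p ∂μ) ∞ with hinf | hfin
  · rw [hinf, ENNReal.mul_top hC0]; exact le_top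
  refine ENNReal.le_of_forall_pos_le_add fun ε₀ hε₀ _ => ?_
  obtain ⟨ε, hε, hεC⟩ := ENNReal.exists_nnreal_pos_mul_lt hCt
    (ENNReal.coe_ne_zero.2 (ne_of_gt hε₀))
  obtain ⟨g', a, hg', hgg', ha0, hat, hag', hint⟩ := exists_lowerSemicontinuous_rpow_le hp0 hg.1
    (μ := μ) (ENNReal.coe_ne_zero.2 (ne_of_gt hε))
  have hg'm : Measurable g' := hg'.measurable
  have hug' : IsUpperGradient g' u := hg.mono hg'm hgg'
  set I := ∫⁻ y, g' y ^ p ∂μ with hI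
  have hIt : I < ∞ := hint.trans_lt (by finiteness)
  -- the truncated path infimum replaces `u` by a lower semicontinuous competitor
  set v : Y → ℝ := fun y => (min (pathInf g' F y) 1).toReal with hv
  have hv0 : ∀ y, 0 ≤ v y := fun y => ENNReal.toReal_nonneg
  have hv1 : ∀ y, v y ≤ 1 := fun y =>
    ENNReal.toReal_mono ENNReal.one_ne_top (min_le_right _ _)
  have hvF : ∀ y ∈ F, v y = 0 := fun y hy => by simp [hv, pathInf_eq_zero hy]
  have hvK : ∀ y ∈ closedBall x r ∩ E, v y = 1 := fun y hy => by
    simp [hv, min_eq_right (one_le_pathInf hug' huF (huK y hy))]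
  have hvl : LowerSemicontinuous v := by
    have hc : Continuous (fun z : ℝ≥0∞ => (min z 1).toReal) :=
      ENNReal.continuousOn_toReal.comp_continuous (continuous_id.min continuous_const)
        (fun z => by simp)
    exact hc.comp_lowerSemicontinuous (lowerSemicontinuous_pathInf hFc hg' ha0 hat hag')
      fun c d hcd => ENNReal.toReal_mono (by simp) (min_le_min_right _ hcd)
  have hvm : Measurable v := hvl.measurable
  have hvg : IsUpperGradient g' v := isUpperGradient_pathInf hg'm F
  have hvN : MemNewtonSobolev p μ v := ⟨memLp_of_mem_Icc hvm hv0 hv1 _, g', hvg, hIt⟩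
  have hpair : PoincarePair p A l μ v g' := fun y s hs => by
    simpa only [Real.enorm_eq_ofReal_abs] using hP v hvN g' hvg y s hs
  have hM := hmaz v g' hvl hv0 hv1 hg'm hpair x hx r hr hrE hvK
  -- interpolate between `v` and `1` on the ball
  set k : NNReal := (r⁻¹).toNNReal with hk
  set h : Y → ℝ≥0∞ := (ball x (2 * r)).indicator fun _ => (k : ℝ≥0∞) with hh
  have hhk : ∀ y, h y ≤ k := fun y => indicator_le_self' (fun _ _ => by positivity) y
  have hkr : (k : ℝ≥0∞) ^ p * ENNReal.ofReal r ^ p = 1 := by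
    have : (k : ℝ≥0∞) = ENNReal.ofReal r⁻¹ := rfl
    rw [← ENNReal.mul_rpow_of_nonneg _ _ hp0.le, this, ← ENNReal.ofReal_mul (by positivity),
      inv_mul_cancel₀ hr.ne', ENNReal.ofReal_one, ENNReal.one_rpow]
  set w : Y → ℝ := fun y => v y + cutoff x r y * (1 - v y) with hw
  have hφm : Measurable (cutoff x r) := (lipschitzWith_cutoff x hr).continuous.measurable
  have hwm : Measurable w := by fun_prop
  have hw0 : ∀ y, 0 ≤ w y := fun y =>
    add_nonneg (hv0 y) (mul_nonneg (cutoff_nonneg x r y) (sub_nonneg.2 (hv1 y)))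
  have hw1 : ∀ y, w y ≤ 1 := fun y => by
    have := mul_le_of_le_one_left (sub_nonneg.2 (hv1 y)) (cutoff_le_one x r y)
    simp only [hw]; linarith
  have hwg := hvg.add_mul_one_sub (isUpperGradient_cutoff x hr) hvm (cutoff_nonneg x r)
    (cutoff_le_one x r) hhk
  have hwint : ∫⁻ y, (g' y + ‖1 - v y‖ₑ * h y) ^ p ∂μ ≤ C * I := by
    calc ∫⁻ y, (g' y + ‖1 - v y‖ₑ * h y) ^ p ∂μ
        ≤ ∫⁻ y, 2 ^ (p - 1) * (g' y ^ p +
            (ball x (2 * r)).indicator (fun y => (k : ℝ≥0∞) ^ p * ‖1 - v y‖ₑ ^ p) y) ∂μ := by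
          refine lintegral_mono fun y => ?_
          refine (ENNReal.rpow_add_le_mul_rpow_add_rpow _ _ hp.le).trans_eq ?_
          congr 2
          by_cases hy : y ∈ ball x (2 * r)
          · rw [hh, indicator_of_mem hy, indicator_of_mem hy,
              ENNReal.mul_rpow_of_nonneg _ _ hp0.le, mul_comm]
          · rw [hh, indicator_of_notMem hy, indicator_of_notMem hy, mul_zero,
              ENNReal.zero_rpow_of_pos hp0]
      _ = 2 ^ (p - 1) * (I + k ^ p * ∫⁻ y in ball x (2 * r), ‖1 - v y‖ₑ ^ p ∂μ) := by
          rw [lintegral_const_mul' _ _ h2p, lintegral_add_left (hg'm.pow_const p),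
            lintegral_indicator measurableSet_ball, lintegral_const_mul' _ _
            (ENNReal.rpow_ne_top_of_nonneg hp0.le ENNReal.coe_ne_top)]
      _ ≤ 2 ^ (p - 1) * (I + k ^ p * (C₁ * ENNReal.ofReal r ^ p * I)) := by gcongr
      _ = 2 ^ (p - 1) * (I + C₁ * (k ^ p * ENNReal.ofReal r ^ p) * I) := by ring
      _ = C * I := by rw [hkr, hC]; ring
  have hwN : MemNewtonSobolev p μ w :=
    ⟨memLp_of_mem_Icc hwm hw0 hw1 _, _, hwg, hwint.trans_lt (by finiteness)⟩
  calc relCapacity p μ (closedBall x r) F ≤ energy p μ w := by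
        refine iInf_le_of_le w (iInf_le_of_le hwN (iInf_le_of_le (fun y hy => ?_)
          (iInf_le _ fun y hy => ?_)))
        · simp [hw, cutoff_eq_one hr hy]
        · simp [hw, hvF y hy, cutoff_eq_zero hr hy]
    _ ≤ ∫⁻ y, (g' y + ‖1 - v y‖ₑ * h y) ^ p ∂μ := iInf_le_of_le _ (iInf_le _ hwg)
    _ ≤ C * ((∫⁻ y, g y ^ p ∂μ) + ε) := hwint.trans (by gcongr)
    _ ≤ _ := by
        rw [mul_add, mul_comm C (ε : ℝ≥0∞)]
        gcongr

theorem relCapacity_closedBall_ne_top [CompactSpace Y] [BorelSpace Y] {p : ℝ} (hp : 0 < p)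
    {μ : Measure Y} (hμ : IsDoubling μ) (x : Y) {r : ℝ} (hr : 0 < r) :
    relCapacity p μ (closedBall x r) (ball x (2 * r))ᶜ ≠ ∞ := by
  have := hμ.isFiniteMeasure
  have hg := isUpperGradient_cutoff x hr
  have hint : ∫⁻ y, (ball x (2 * r)).indicator (fun _ => ((r⁻¹).toNNReal : ℝ≥0∞)) y ^ p ∂μ < ∞ := by
    have hkp : (((r⁻¹).toNNReal : ℝ≥0∞)) ^ p ≠ ∞ :=
      ENNReal.rpow_ne_top_of_nonneg hp.le ENNReal.coe_ne_top
    refine lt_of_le_of_lt (lintegral_mono fun y => ?_)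
      (b := ∫⁻ _, ((r⁻¹).toNNReal : ℝ≥0∞) ^ p ∂μ) ?_
    · dsimp only
      gcongr
      exact indicator_le_self' (fun _ _ => by positivity) y
    · rw [lintegral_const]; finiteness
  refine ne_top_of_le_ne_top hint.ne (iInf_le_of_le (cutoff x r) (iInf_le_of_le ?_
    (iInf_le_of_le (fun y hy => (cutoff_eq_one hr hy).ge) (iInf_le_of_le
      (fun y hy => cutoff_eq_zero hr hy) (iInf_le_of_le _ (iInf_le _ hg))))))
  exact ⟨memLp_of_mem_Icc (lipschitzWith_cutoff x hr).continuous.measurable (cutoff_nonneg x r)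
    (cutoff_le_one x r) _, _, hg, hint⟩

/-- By the Poincaré inequality on the whole space, the relative capacity of two sets of positive
measure is positive. -/
theorem relCapacity_ne_zero [CompactSpace Y] [BorelSpace Y] {p : ℝ} (hp : 0 < p)
    {μ : Measure Y} (hμ : IsDoubling μ) (hP : SupportsPoincare p μ) {K F : Set Y}
    (hK : MeasurableSet K) (hF : MeasurableSet F) (hK0 : μ K ≠ 0) (hF0 : μ F ≠ 0) :
    relCapacity p μ K F ≠ 0 := by
  have := hμ.isFiniteMeasure
  obtain ⟨A, l, hA, hl, hP⟩ := hP
  obtain ⟨x, -⟩ := nonempty_of_measure_ne_zero hK0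
  obtain ⟨R, hR0, hR⟩ := (isCompact_univ (X := Y)).isBounded.subset_ball_lt 0 x
  have hball : ∀ s, R ≤ s → ball x s = univ := fun s hs =>
    univ_subset_iff.1 (hR.trans (ball_subset_ball hs))
  set m := min (μ K) (μ F) with hm
  have hm0 : m ≠ 0 := by simp [hm, hK0, hF0, min_eq_iff]
  have hμ0 : μ univ ≠ 0 := fun h => hK0 (measure_mono_null (subset_univ _) h)
  have hμt : μ univ ≠ ∞ := measure_ne_top _ _
  have hAR : ENNReal.ofReal (A * R) ≠ 0 := by simpa using mul_pos hA hR0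
  -- the lower bound for `∫ g ^ p` that the Poincaré inequality on `B(x, R) = Y` yields
  set c : ℝ≥0∞ := (2⁻¹ * m / μ univ / ENNReal.ofReal (A * R)) ^ p * μ univ with hc
  have hmt : m ≠ ∞ := ne_top_of_le_ne_top (measure_ne_top μ K) (min_le_left _ _)
  have hc0 : c ≠ 0 := by
    refine mul_ne_zero (ENNReal.rpow_pos ?_ ?_).ne' hμ0
    · exact ENNReal.div_pos (ENNReal.div_pos (mul_ne_zero (by simp) hm0) hμt).ne'
        ENNReal.ofReal_ne_top
    · exact ENNReal.div_ne_top (ENNReal.div_ne_top (ENNReal.mul_ne_top (by simp) hmt) hμ0) hAR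
  suffices h : c ≤ relCapacity p μ K F from fun h0 => hc0 (le_antisymm (h0 ▸ h) (by positivity))
  refine le_iInf fun u => le_iInf fun hu => le_iInf fun huK => le_iInf fun huF =>
    le_iInf fun g => le_iInf fun hg => ?_
  have hPu := hP u hu g hg x R hR0
  rw [hball R le_rfl, hball (l * R) (by nlinarith)] at hPu
  set M := ⨍ z in univ, u z ∂μ with hM
  have hhalf : (2⁻¹ : ℝ≥0∞) = ENNReal.ofReal 2⁻¹ := by
    rw [ENNReal.ofReal_inv_of_pos (by norm_num)]; simp
  have key : ∀ S : Set Y, MeasurableSet S → (∀ y ∈ S, 2⁻¹ ≤ |u y - M|) →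
      2⁻¹ * μ S ≤ ∫⁻ y in univ, ENNReal.ofReal |u y - M| ∂μ := by
    intro S hS h
    calc 2⁻¹ * μ S = ∫⁻ _ in S, 2⁻¹ ∂μ := by simp
      _ ≤ ∫⁻ y in S, ENNReal.ofReal |u y - M| ∂μ := setLIntegral_mono' hS fun y hy => by
          rw [hhalf]; exact ENNReal.ofReal_le_ofReal (h y hy)
      _ ≤ _ := lintegral_mono_set (subset_univ _)
  -- the mean value of `u` is at distance at least `1/2` from either `[1, ∞)` or `0`
  have h1 : 2⁻¹ * m ≤ ∫⁻ y in univ, ENNReal.ofReal |u y - M| ∂μ := by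
    rcases le_total M 2⁻¹ with hM2 | hM2
    · refine le_trans (by gcongr; exact min_le_left _ _) (key K hK fun y hy => ?_)
      refine le_trans ?_ (le_abs_self _)
      have := huK y hy
      norm_num at hM2 ⊢
      linarith
    · refine le_trans (by gcongr; exact min_le_right _ _) (key F hF fun y hy => ?_)
      rw [huF y hy, zero_sub, abs_neg]
      exact hM2.trans (le_abs_self _)
  rw [setLAverage_eq, setLAverage_eq, setLIntegral_univ (fun y => g y ^ p)] at hPu
  have h2 : 2⁻¹ * m / μ univ / ENNReal.ofReal (A * R) ≤
      ((∫⁻ y, g y ^ p ∂μ) / μ univ) ^ (1 / p) := by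
    refine ENNReal.div_le_of_le_mul' (le_trans ?_ hPu)
    gcongr
  calc c ≤ (((∫⁻ y, g y ^ p ∂μ) / μ univ) ^ (1 / p)) ^ p * μ univ := by rw [hc]; gcongr
    _ = ∫⁻ y, g y ^ p ∂μ := by
      rw [← ENNReal.rpow_mul, one_div_mul_cancel hp.ne', ENNReal.rpow_one,
        ENNReal.div_mul_cancel hμ0 hμt]

omit [MeasurableSpace Y] in
theorem exists_ball_subset_compl_ball {E : Set Y} {x : Y} {r : ℝ} (hr : 0 < r)
    (hrE : r < diam E / 4) : ∃ (z : Y) (s : ℝ), 0 < s ∧ ball z s ⊆ (ball x (2 * r))ᶜ := by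
  obtain ⟨z, hz⟩ : ∃ z, 2 * r < dist z x := by
    by_contra! h
    have := diam_le_of_subset_closedBall (x := x) (r := 2 * r) (s := E) (by positivity)
      fun z _ => h z
    linarith
  refine ⟨z, dist z x - 2 * r, by linarith, fun y hy => ?_⟩
  rw [mem_compl_iff, mem_ball, not_lt]
  rw [mem_ball, dist_comm] at hy
  linarith [dist_triangle z y x]

end MetricSobolev

theorem mainTheorem6 {Y : Type*} [MetricSpace Y] [CompactSpace Y] [MeasurableSpace Y]
    [BorelSpace Y] (p Θ : ℝ) (hp : 1 < p) (hΘ : 0 < Θ) (hΘp : Θ < p)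
    (μ : MeasureTheory.Measure Y) (hμ : MetricSobolev.IsDoubling μ)
    (hPoincare : MetricSobolev.SupportsPoincare p μ)
    (E : Set Y) (hE : IsClosed E) (ν : MeasureTheory.Measure Y)
    (hν : MetricSobolev.IsCodimensional Θ μ ν E) :
    ∃ Λ : ℝ, 0 < Λ ∧ ∀ x ∈ E, ∀ r : ℝ, 0 < r → r < Metric.diam E / 4 →
      ENNReal.ofReal Λ ≤
        MetricSobolev.relCapacity p μ (Metric.closedBall x r ∩ E) (Metric.ball x (2 * r))ᶜ /
          MetricSobolev.relCapacity p μ (Metric.closedBall x r) (Metric.ball x (2 * r))ᶜ := by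
  obtain ⟨C, hC0, hCt, hC⟩ :=
    MetricSobolev.exists_relCapacity_closedBall_le hp hΘ hΘp hμ hPoincare hE hν
  refine ⟨C⁻¹.toReal, ENNReal.toReal_pos (by simpa using hCt) (by simpa using hC0),
    fun x hx r hr hrE => ?_⟩
  obtain ⟨z, s, hs, hzs⟩ := MetricSobolev.exists_ball_subset_compl_ball (x := x) hr hrE
  have hb0 : MetricSobolev.relCapacity p μ (closedBall x r) (ball x (2 * r))ᶜ ≠ 0 :=
    MetricSobolev.relCapacity_ne_zero (by linarith) hμ hPoincare measurableSet_closedBall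
      measurableSet_ball.compl
      (fun h => (hμ.measure_ball_pos x hr).ne' (measure_mono_null ball_subset_closedBall h))
      (fun h => (hμ.measure_ball_pos z hs).ne' (measure_mono_null hzs h))
  have hbt := MetricSobolev.relCapacity_closedBall_ne_top (by linarith : 0 < p) hμ x hr
  rw [ENNReal.ofReal_toReal (by simpa using hC0),
    ENNReal.le_div_iff_mul_le (Or.inl hb0) (Or.inl hbt), mul_comm, ← div_eq_mul_inv]
  exact ENNReal.div_le_of_le_mul' (hC x hx r hr hrE)
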